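/- A Young function is a non-negative convex function $\Psi:\mathbb{R}\to[0,\infty)$ such that $\Psi(t)=0$ if and only if $t=0$. For a positive integer $n$, the $n$-dimensional Orlicz ball of $\Psi$ is $B^n_\Psi=\{x\in\mathbb{R}^n:\ \sum_{i=1}^n\Psi(x_i)\le 1\}$. Write $\langle\cdot,\cdot\rangle$ and $|\cdot|$ for the standard inner product and the Euclidean norm on $\mathbb{R}^n$. Theorem. Let $n\ge 1$, let $\Psi$ be an even Young function such that $t\mapsto\Psi(\sqrt t)$ is convex on $(0,\infty)$, and let $\xi=(\xi_1,\dots,\xi_n)$ be a random vector uniformly distributed on $B^n_\Psi$ (with respect to Lebesgue measure). Then for every $a\in\mathbb{R}^n$, $$\mathbb{E}\,e^{\langle a,\xi\rangle}\ \le\ \Big(\mathbb{E}\,e^{\frac{|a|}{\sqrt n}\,\xi_1}\Big)^n\ \le\ \exp\Big(\tfrac12\,\mathbb{E}\big(\langle a,\xi\rangle^2\big)\Big),$$ all expectations being finite. -/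

import Mathlib

/-- A Young function: a non-negative convex function on `ℝ` which vanishes at `0` and only
at `0`. No symmetry is included. -/
structure IsYoungFunction (Ψ : ℝ → ℝ) : Prop where
  convexOn : ConvexOn ℝ Set.univ Ψ
  nonneg : ∀ t, 0 ≤ Ψ t
  eq_zero_iff : ∀ t, Ψ t = 0 ↔ t = 0

/-- The `n`-dimensional Orlicz ball `{x ∈ ℝⁿ : Ψ(x₁) + ⋯ + Ψ(xₙ) ≤ 1}`. -/
def orliczBall (n : ℕ) (Ψ : ℝ → ℝ) : Set (EuclideanSpace ℝ (Fin n)) :=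
  {x | ∑ i, Ψ (x i) ≤ 1}

/-! Negative association of the `|ξᵢ|` reduces the Laplace transform to one coordinate; a
log-concavity property of the even moments of that coordinate then yields both inequalities. Let
V_m(r) be the volume of {∑ Ψ(xᵢ) ≤ r} in dimension m. One coordinate of ξ has density proportional
to ρ(x) = V_{n-1}(1 - Ψ(x)). As Ψ is convex, the substitution Ψ(g(y)) = Ψ(y) + d, which compensates
a rise of the level by d, is a contraction of the half-line. Hence V_m is log-concave
(`orliczVolume_isShiftLogConcave`), and means of products of increasing functions of the |xᵢ| over
the ball grow with the level (`orliczIter_monotone_ratio`). A large |x₁| lowers the level left to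
the other coordinates, so Chebyshev's inequality, applied one coordinate at a time, bounds the mean
of such a product by the product of the means (`orliczIter_negative_association`). Since Ψ is even,
each exp(aᵢxᵢ) may be replaced by cosh(aᵢxᵢ), which increases with |xᵢ|. It remains to study F(s) =
∑ c_k s^k / k! at s = a², where c_k is the 2k-th moment of ρ times k!/(2k)!, that is, the moment
divided by the Gaussian one up to 2^k. Convexity of Ψ(√t) and log-concavity of V make ρ(x)ρ(y)
increase along circles towards the diagonals, and polar coordinates turn this into log-concavity of
c (`moment_log_concave`). Then log F is concave on [0, ∞) (`expSeries_log_concaveOn`), and Jensen at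
the points aᵢ² gives the first inequality. Also c_k ≤ c_0 (c_1/c_0)^k gives F(s) ≤ c_0 exp(c_1 s /
c_0) (`expSeries_le_exp`); as c_1/c_0 is half the variance of a coordinate, this is the second. -/

open MeasureTheory Set Filter Topology
open scoped ENNReal

/-! ### Young functions: monotonicity, inverse values, level shifts. -/

namespace IsYoungFunction

variable {Ψ : ℝ → ℝ}

theorem continuous (hΨ : IsYoungFunction Ψ) : Continuous Ψ :=
  continuousOn_univ.mp (hΨ.convexOn.continuousOn isOpen_univ)

theorem map_zero (hΨ : IsYoungFunction Ψ) : Ψ 0 = 0 := (hΨ.eq_zero_iff 0).2 rfl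

theorem pos (hΨ : IsYoungFunction Ψ) {t : ℝ} (ht : t ≠ 0) : 0 < Ψ t :=
  lt_of_le_of_ne (hΨ.nonneg t) fun h => ht ((hΨ.eq_zero_iff t).1 h.symm)

theorem mul_le (hΨ : IsYoungFunction Ψ) {c y : ℝ} (hc : 0 ≤ c) (hc1 : c ≤ 1) :
    Ψ (c * y) ≤ c * Ψ y := by
  have h := hΨ.convexOn.2 (mem_univ y) (mem_univ 0) hc (sub_nonneg.2 hc1) (by ring)
  simpa [hΨ.map_zero] using h

theorem strictMonoOn (hΨ : IsYoungFunction Ψ) : StrictMonoOn Ψ (Ici 0) := by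
  intro x hx y hy hxy
  have hy0 : 0 < y := lt_of_le_of_lt hx hxy
  have h := hΨ.mul_le (c := x / y) (y := y) (div_nonneg hx hy0.le) (div_le_one_of_le₀ hxy.le hy0.le)
  rw [div_mul_cancel₀ _ hy0.ne'] at h
  have h1 : x / y < 1 := (div_lt_one hy0).2 hxy
  nlinarith [hΨ.pos hy0.ne']

theorem apply_abs (hev : Function.Even Ψ) (x : ℝ) : Ψ |x| = Ψ x := by
  rcases abs_choice x with h | h <;> simp [h, hev x]

theorem le_iff_abs_le (hΨ : IsYoungFunction Ψ) (hev : Function.Even Ψ) {x y : ℝ} :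
    Ψ x ≤ Ψ y ↔ |x| ≤ |y| := by
  rw [← apply_abs hev x, ← apply_abs hev y]
  exact hΨ.strictMonoOn.le_iff_le (abs_nonneg x) (abs_nonneg y)

theorem exists_nonneg_eq (hΨ : IsYoungFunction Ψ) {u : ℝ} (hu : 0 ≤ u) :
    ∃ x, 0 ≤ x ∧ Ψ x = u := by
  have h1 : 0 < Ψ 1 := hΨ.pos one_ne_zero
  set b := u / Ψ 1 + 1 with hb
  have hb1 : 1 ≤ b := by have : 0 ≤ u / Ψ 1 := by positivity
                         linarith
  have hb0 : 0 < b := by linarith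
  have h := hΨ.mul_le (c := 1 / b) (y := b) (by positivity) ((div_le_one hb0).2 hb1)
  rw [one_div, inv_mul_cancel₀ hb0.ne', inv_mul_eq_div, le_div_iff₀ hb0] at h
  have h2 : u ≤ Ψ b := by
    refine le_trans ?_ h
    rw [hb, mul_add, mul_div_cancel₀ _ h1.ne']
    linarith
  obtain ⟨x, hx, hxu⟩ := intermediate_value_Icc hb0.le hΨ.continuous.continuousOn
    (show u ∈ Icc (Ψ 0) (Ψ b) from ⟨by rw [hΨ.map_zero]; exact hu, h2⟩)
  exact ⟨x, hx.1, hxu⟩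

theorem exists_abs_le (hΨ : IsYoungFunction Ψ) (hev : Function.Even Ψ) (r : ℝ) :
    ∃ R, 0 < R ∧ ∀ x, Ψ x ≤ r → |x| ≤ R := by
  obtain ⟨x, hx, hxr⟩ := hΨ.exists_nonneg_eq (le_max_right r 0)
  refine ⟨x + 1, by linarith, fun y hy => ?_⟩
  have : |y| ≤ |x| := (hΨ.le_iff_abs_le hev).1 (by rw [hxr]; exact hy.trans (le_max_left _ _))
  rw [abs_of_nonneg hx] at this
  linarith

/-- Shifting the value of a Young function by a constant is a contraction of the half-line. -/
theorem exists_lipschitz_shift (hΨ : IsYoungFunction Ψ) {d : ℝ} (hd : 0 ≤ d) :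
    ∃ g : ℝ → ℝ, LipschitzOnWith 1 g (Ici 0) ∧ (∀ y, 0 ≤ g y) ∧ (∀ y, Ψ (g y) = Ψ y + d) := by
  choose g hg0 hg using fun y => hΨ.exists_nonneg_eq (add_nonneg (hΨ.nonneg y) hd)
  refine ⟨g, ?_, hg0, hg⟩
  have key : ∀ x y, 0 ≤ x → x < y → |g y - g x| ≤ y - x := by
    intro x y hx hxy
    have hy : 0 ≤ y := hx.trans hxy.le
    have hΨxy := hΨ.strictMonoOn hx hy hxy
    have hgx : x ≤ g x := (hΨ.strictMonoOn.le_iff_le hx (hg0 x)).1 (by rw [hg]; linarith)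
    have hgy : y ≤ g y := (hΨ.strictMonoOn.le_iff_le hy (hg0 y)).1 (by rw [hg]; linarith)
    have hgxy : g x < g y := (hΨ.strictMonoOn.lt_iff_lt (hg0 x) (hg0 y)).1 (by rw [hg, hg]; linarith)
    rw [abs_of_pos (sub_pos.2 hgxy)]
    -- Secant slopes grow from [x, y] to [x, g y] to [g x, g y]. The rise of Ψ over the first and
    -- the last interval is the same, so the last is the shorter one.
    have s1 : (Ψ y - Ψ x) / (y - x) ≤ (Ψ (g y) - Ψ x) / (g y - x) :=
      hΨ.convexOn.secant_mono (mem_univ x) (mem_univ y) (mem_univ _) hxy.ne'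
        (by linarith) hgy
    have s2 : (Ψ x - Ψ (g y)) / (x - g y) ≤ (Ψ (g x) - Ψ (g y)) / (g x - g y) :=
      hΨ.convexOn.secant_mono (mem_univ (g y)) (mem_univ x) (mem_univ _) (by linarith)
        hgxy.ne hgx
    have s3 : (Ψ y - Ψ x) / (y - x) ≤ (Ψ y - Ψ x) / (g y - g x) := by
      calc _ ≤ _ := s1
        _ = (Ψ x - Ψ (g y)) / (x - g y) := by rw [← neg_sub, ← neg_sub x, neg_div_neg_eq]
        _ ≤ _ := s2
        _ = _ := by rw [← neg_sub, ← neg_sub (g y) (g x), neg_div_neg_eq, hg, hg]; congr 1; ring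
    rw [div_le_div_iff_of_pos_left (sub_pos.2 hΨxy) (sub_pos.2 hxy) (sub_pos.2 hgxy)] at s3
    exact s3
  refine LipschitzOnWith.of_dist_le_mul fun x hx y hy => ?_
  rw [NNReal.coe_one, one_mul, Real.dist_eq, Real.dist_eq]
  rcases lt_trichotomy x y with h | h | h
  · rw [abs_sub_comm, abs_sub_comm x, abs_of_pos (sub_pos.2 h)]; exact key x y hx h
  · simp [h]
  · rw [abs_of_pos (sub_pos.2 h)]; exact key y x hy h

end IsYoungFunction

theorem lintegral_even_eq {F : ℝ → ℝ≥0∞} (hF : ∀ x, F (-x) = F x) :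
    ∫⁻ x, F x = 2 * ∫⁻ x in Ici 0, F x := by
  have h : ∫⁻ x in Iio 0, F x = ∫⁻ x in Ioi 0, F x := by
    have hmp : MeasurePreserving (Neg.neg : ℝ → ℝ) volume volume := Measure.measurePreserving_neg _
    have := hmp.setLIntegral_comp_preimage_emb (MeasurableEquiv.neg ℝ).measurableEmbedding
      F (Ioi 0)
    rw [← this]
    simp [hF]
  rw [← lintegral_add_compl F (measurableSet_Ici (a := (0 : ℝ))), compl_Ici, h,
    setLIntegral_congr Ioi_ae_eq_Ici, two_mul]

/-- The part of `x ↦ h (r - Ψ x)` coming from values of `h` below a level decreases with `r`. -/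
theorem IsYoungFunction.lintegral_shift_le {Ψ : ℝ → ℝ} (hΨ : IsYoungFunction Ψ)
    (hev : Function.Even Ψ) {h : ℝ → ℝ≥0∞} (hm : Measurable h) {r r' : ℝ} (hr : r ≤ r')
    (h0 : ∀ y, r ≤ y → h y = 0) :
    ∫⁻ x, h (r' - Ψ x) ≤ ∫⁻ x, h (r - Ψ x) := by
  -- Substituting x = g y turns r' - Ψ x into r - Ψ y. Points 0 ≤ x < g 0, missed by g, satisfy r' -
  -- Ψ x > r, where h vanishes.
  obtain ⟨g, hgL, hg0, hg⟩ := hΨ.exists_lipschitz_shift (sub_nonneg.2 hr)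
  rw [lintegral_even_eq (fun x => by rw [hev x]), lintegral_even_eq (fun x => by rw [hev x])]
  gcongr 2 * ?_
  have hgc : ContinuousOn g (Ici 0) := hgL.continuousOn
  have hgm : AEMeasurable g (volume.restrict (Ici 0)) := hgc.aemeasurable measurableSet_Ici
  have hsub : Ici (g 0) ⊆ g '' Ici 0 := by
    intro x hx
    have hx0 : 0 ≤ x := (hg0 0).trans hx
    have h1 : Ψ (g 0) ≤ Ψ x := hΨ.strictMonoOn.monotoneOn (hg0 0) hx0 hx
    rw [hg, hΨ.map_zero] at h1
    obtain ⟨y, hy, hyx⟩ := hΨ.exists_nonneg_eq (u := Ψ x - (r' - r)) (by linarith)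
    refine ⟨y, hy, hΨ.strictMonoOn.injOn (hg0 y) hx0 ?_⟩
    rw [hg, hyx]; ring
  -- A contraction does not increase length, seen as one-dimensional Hausdorff measure, so a set
  -- covered by g has a preimage at least as long.
  have hmeas : (volume : Measure ℝ).restrict (Ici (g 0)) ≤ (volume.restrict (Ici 0)).map g := by
    refine Measure.le_iff.2 fun s hs => ?_
    rw [Measure.map_apply_of_aemeasurable hgm hs, Measure.restrict_apply hs,
      Measure.restrict_apply₀' measurableSet_Ici.nullMeasurableSet]
    calc volume (s ∩ Ici (g 0)) ≤ volume (g '' (g ⁻¹' s ∩ Ici 0)) := by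
          refine measure_mono ?_
          rintro x ⟨hxs, hx⟩
          obtain ⟨y, hy, rfl⟩ := hsub hx
          exact ⟨y, ⟨hxs, hy⟩, rfl⟩
      _ ≤ volume (g ⁻¹' s ∩ Ici 0) := by
          have := (hgL.mono inter_subset_right).hausdorffMeasure_image_le (s := g ⁻¹' s ∩ Ici 0)
            (zero_le_one (α := ℝ))
          simpa [hausdorffMeasure_real] using this
  calc ∫⁻ x in Ici 0, h (r' - Ψ x) = ∫⁻ x in Ici (g 0), h (r' - Ψ x) := by
        rw [← lintegral_indicator measurableSet_Ici, ← lintegral_indicator measurableSet_Ici]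
        congr 1
        ext x
        by_cases hx : x ∈ Ici (g 0)
        · have : x ∈ Ici (0 : ℝ) := (hg0 0).trans hx
          simp only [indicator_of_mem, hx, this]
        · rw [indicator_of_notMem hx]
          by_cases hx0 : x ∈ Ici (0 : ℝ)
          · rw [indicator_of_mem hx0]
            apply h0
            have := hΨ.strictMonoOn hx0 (hg0 0) (not_le.1 hx)
            rw [hg, hΨ.map_zero] at this
            linarith
          · rw [indicator_of_notMem hx0]
    _ ≤ ∫⁻ x, h (r' - Ψ x) ∂((volume.restrict (Ici 0)).map g) := lintegral_mono' hmeas le_rfl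
    _ = ∫⁻ y in Ici 0, h (r' - Ψ (g y)) := by
        apply lintegral_map' _ hgm
        have := hΨ.continuous
        exact (hm.comp (by fun_prop)).aemeasurable
    _ = ∫⁻ y in Ici 0, h (r - Ψ y) := by
        congr 1; ext y; rw [hg]; congr 1; ring

/-! ### Layer-cake formulas for extended non-negative functions. -/

section LayerCake

variable {α : Type*} [MeasurableSpace α]

theorem lintegral_eq_lintegral_measure_ofReal_lt (m : Measure α) [SFinite m] {f : α → ℝ≥0∞}
    (hf : Measurable f) :
    ∫⁻ x, f x ∂m = ∫⁻ t in Ioi (0 : ℝ), m {x | ENNReal.ofReal t < f x} := by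
  have h1 : ∀ c : ℝ≥0∞, c = ∫⁻ t in Ioi (0 : ℝ), {t | ENNReal.ofReal t < c}.indicator 1 t := by
    intro c
    have hms : MeasurableSet {t : ℝ | ENNReal.ofReal t < c} :=
      measurableSet_lt ENNReal.measurable_ofReal measurable_const
    rw [lintegral_indicator_one hms, Measure.restrict_apply hms]
    rcases eq_or_ne c ∞ with rfl | hc
    · have : {t : ℝ | ENNReal.ofReal t < ∞} ∩ Ioi 0 = Ioi 0 := by ext; simp
      rw [this, Real.volume_Ioi]
    · have : {t : ℝ | ENNReal.ofReal t < c} ∩ Ioi 0 = Ioo 0 c.toReal := by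
        ext t
        simp only [mem_inter_iff, mem_ofPred_eq, mem_Ioi, mem_Ioo]
        constructor
        · rintro ⟨h, h0⟩; exact ⟨h0, (ENNReal.ofReal_lt_iff_lt_toReal h0.le hc).1 h⟩
        · rintro ⟨h0, h⟩; exact ⟨(ENNReal.ofReal_lt_iff_lt_toReal h0.le hc).2 h, h0⟩
      rw [this, Real.volume_Ioo, sub_zero, ENNReal.ofReal_toReal hc]
  have hms : MeasurableSet {p : α × ℝ | ENNReal.ofReal p.2 < f p.1} :=
    measurableSet_lt (ENNReal.measurable_ofReal.comp measurable_snd) (hf.comp measurable_fst)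
  calc ∫⁻ x, f x ∂m
      = ∫⁻ x, (∫⁻ t in Ioi (0 : ℝ), {t | ENNReal.ofReal t < f x}.indicator 1 t) ∂m :=
        lintegral_congr fun x => h1 (f x)
    _ = ∫⁻ t in Ioi (0 : ℝ), ∫⁻ x, {t | ENNReal.ofReal t < f x}.indicator 1 t ∂m := by
        apply lintegral_lintegral_swap
        exact ((measurable_one (α := ℝ≥0∞) (β := α × ℝ)).indicator hms).aemeasurable
    _ = _ := by
        refine lintegral_congr fun t => ?_
        rw [← lintegral_indicator_one (measurableSet_lt measurable_const hf)]
        rfl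

theorem lintegral_mul_eq_lintegral_measure_inter (m : Measure α) [SFinite m] {f g : α → ℝ≥0∞}
    (hf : Measurable f) (hg : Measurable g) :
    ∫⁻ x, g x * f x ∂m = ∫⁻ t in Ioi (0 : ℝ), ∫⁻ s in Ioi (0 : ℝ),
      m ({x | ENNReal.ofReal t < f x} ∩ {x | ENNReal.ofReal s < g x}) := by
  have h := lintegral_withDensity_eq_lintegral_mul m hg hf
  simp only [Pi.mul_apply] at h
  rw [← h, lintegral_eq_lintegral_measure_ofReal_lt _ hf]
  refine lintegral_congr fun t => ?_
  have hms : MeasurableSet {x | ENNReal.ofReal t < f x} := measurableSet_lt measurable_const hf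
  rw [withDensity_apply _ hms, lintegral_eq_lintegral_measure_ofReal_lt _ hg]
  refine lintegral_congr fun s => ?_
  rw [Measure.restrict_apply (measurableSet_lt measurable_const hg), inter_comm]

end LayerCake

/-- Log-concavity of a function on the line, in multiplicative form. -/
def IsShiftLogConcave (V : ℝ → ℝ≥0∞) : Prop :=
  ∀ v v' h, 0 ≤ h → v ≤ v' → V (v - h) * V v' ≤ V (v' - h) * V v

/-- The measure on the line with density `x ↦ V (r - Ψ x)`. -/
noncomputable def levelMeasure (Ψ : ℝ → ℝ) (V : ℝ → ℝ≥0∞) (r : ℝ) : Measure ℝ :=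
  volume.withDensity fun x => V (r - Ψ x)

/-- The weighted convolution `r ↦ ∫ f x * W (r - Ψ x) dx`. -/
noncomputable def orliczConv (Ψ : ℝ → ℝ) (f W : ℝ → ℝ≥0∞) (r : ℝ) : ℝ≥0∞ :=
  ∫⁻ x, f x * W (r - Ψ x)

/-! ### How weighted one-dimensional integrals vary with the level. -/

section Level

variable {Ψ : ℝ → ℝ} {V : ℝ → ℝ≥0∞}

instance (r : ℝ) : SFinite (levelMeasure Ψ V r) := by
  unfold levelMeasure; infer_instance

theorem levelMeasure_apply {s : Set ℝ} (hs : MeasurableSet s) (r : ℝ) :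
    levelMeasure Ψ V r s = ∫⁻ x in s, V (r - Ψ x) := withDensity_apply _ hs

theorem levelMeasure_univ (r : ℝ) : levelMeasure Ψ V r univ = orliczConv Ψ 1 V r := by
  simp [levelMeasure_apply MeasurableSet.univ, orliczConv]

theorem measurable_comp_level (hΨ : IsYoungFunction Ψ) (hV : Measurable V) (r : ℝ) :
    Measurable fun x => V (r - Ψ x) := by
  have := hΨ.continuous
  exact hV.comp (by fun_prop)

theorem orliczConv_mul_eq (hΨ : IsYoungFunction Ψ) (hV : Measurable V) {f K : ℝ → ℝ≥0∞}
    (hf : Measurable f) (hK : Measurable K) (r : ℝ) :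
    orliczConv Ψ f (fun y => K y * V y) r
      = ∫⁻ x, K (r - Ψ x) * f x ∂(levelMeasure Ψ V r) := by
  have h := lintegral_withDensity_eq_lintegral_mul volume (measurable_comp_level hΨ hV r)
    ((measurable_comp_level hΨ hK r).mul hf)
  refine Eq.trans (lintegral_congr fun x => ?_) h.symm
  simp only [Pi.mul_apply]
  ring

theorem measurableSet_level (hΨ : IsYoungFunction Ψ) {S : Set ℝ} (hS : IsUpperSet S) (r : ℝ) :
    MeasurableSet {x | r - Ψ x ∈ S} := by
  have := hΨ.continuous
  exact hS.ordConnected.measurableSet.preimage (by fun_prop : Measurable fun x => r - Ψ x)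

/-- The contraction argument applies to V cut off to the complement of S: it vanishes on [r, ∞)
because S is an upper set containing r. -/
theorem levelMeasure_compl_level_le (hΨ : IsYoungFunction Ψ) (hev : Function.Even Ψ)
    (hV : Measurable V) {S : Set ℝ} (hS : IsUpperSet S) {r r' : ℝ} (hr : r ≤ r') (hrS : r ∈ S) :
    levelMeasure Ψ V r' {x | r' - Ψ x ∈ S}ᶜ ≤ levelMeasure Ψ V r {x | r - Ψ x ∈ S}ᶜ := by
  have hSm := hS.ordConnected.measurableSet
  have key : ∀ r, levelMeasure Ψ V r {x | r - Ψ x ∈ S}ᶜ = ∫⁻ x, Sᶜ.indicator V (r - Ψ x) := by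
    intro r
    rw [levelMeasure_apply (measurableSet_level hΨ hS r).compl,
      ← lintegral_indicator (measurableSet_level hΨ hS r).compl]
    rfl
  rw [key, key]
  refine hΨ.lintegral_shift_le hev (hV.indicator hSm.compl) hr fun y hy => ?_
  exact indicator_of_notMem (fun h => (mem_compl_iff _ _).1 h (hS hy hrS)) _

theorem levelMeasure_level_mono (hΨ : IsYoungFunction Ψ) (hV : Monotone V)
    {S : Set ℝ} (hS : IsUpperSet S) {r r' : ℝ} (hr : r ≤ r') :
    levelMeasure Ψ V r {x | r - Ψ x ∈ S} ≤ levelMeasure Ψ V r' {x | r' - Ψ x ∈ S} := by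
  rw [levelMeasure_apply (measurableSet_level hΨ hS r),
    levelMeasure_apply (measurableSet_level hΨ hS r')]
  calc _ ≤ ∫⁻ x in {x | r - Ψ x ∈ S}, V (r' - Ψ x) :=
        lintegral_mono fun x => hV (by linarith)
    _ ≤ _ := lintegral_mono_set fun x hx => by
        rw [mem_ofPred_eq] at hx ⊢
        exact hS (by linarith) hx

/-- As the level rises, the mass of the central region grows and the mass outside it shrinks, so its
proportion grows. If r is not in S, the region is empty at level r. -/
theorem levelMeasure_level_mul_le (hΨ : IsYoungFunction Ψ) (hev : Function.Even Ψ)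
    (hV : Monotone V) {S : Set ℝ} (hS : IsUpperSet S) {r r' : ℝ} (hr : r ≤ r') :
    levelMeasure Ψ V r {x | r - Ψ x ∈ S} * levelMeasure Ψ V r' univ
      ≤ levelMeasure Ψ V r' {x | r' - Ψ x ∈ S} * levelMeasure Ψ V r univ := by
  by_cases hrS : r ∈ S
  · have h1 := levelMeasure_compl_level_le hΨ hev hV.measurable hS hr hrS
    have h2 := levelMeasure_level_mono hΨ hV hS hr
    rw [← measure_add_measure_compl (μ := levelMeasure Ψ V r) (measurableSet_level hΨ hS r),
      ← measure_add_measure_compl (μ := levelMeasure Ψ V r') (measurableSet_level hΨ hS r'),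
      mul_add, mul_add]
    refine add_le_add (mul_comm _ _).le (mul_le_mul' h2 h1)
  · have : {x | r - Ψ x ∈ S} = ∅ := by
      ext x
      simp only [mem_ofPred_eq, mem_empty_iff_false, iff_false]
      exact fun h => hrS (hS (by linarith [hΨ.nonneg x]) h)
    simp [this]

theorem isUpperSet_lt_of_monotone {K : ℝ → ℝ≥0∞} (hK : Monotone K) (c : ℝ≥0∞) :
    IsUpperSet {y | c < K y} := fun _ _ hab ha => lt_of_lt_of_le ha (hK hab)

theorem orliczConv_mul_monotone_ratio (hΨ : IsYoungFunction Ψ) (hev : Function.Even Ψ)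
    (hV : Monotone V) (hfin : ∀ r, orliczConv Ψ 1 V r ≠ ∞) {K : ℝ → ℝ≥0∞} (hK : Monotone K)
    {r r' : ℝ} (hr : r ≤ r') :
    orliczConv Ψ 1 (fun y => K y * V y) r * orliczConv Ψ 1 V r'
      ≤ orliczConv Ψ 1 (fun y => K y * V y) r' * orliczConv Ψ 1 V r := by
  rw [orliczConv_mul_eq hΨ hV.measurable measurable_one hK.measurable,
    orliczConv_mul_eq hΨ hV.measurable measurable_one hK.measurable]
  simp only [Pi.one_apply, mul_one]
  rw [lintegral_eq_lintegral_measure_ofReal_lt _ (measurable_comp_level hΨ hK.measurable r),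
    lintegral_eq_lintegral_measure_ofReal_lt _ (measurable_comp_level hΨ hK.measurable r'),
    ← lintegral_mul_const' _ _ (hfin _), ← lintegral_mul_const' _ _ (hfin _)]
  refine lintegral_mono fun t => ?_
  rw [← levelMeasure_univ, ← levelMeasure_univ]
  exact levelMeasure_level_mul_le hΨ hev hV (isUpperSet_lt_of_monotone hK _) hr

theorem orliczConv_one_shift (V : ℝ → ℝ≥0∞) (h v : ℝ) :
    orliczConv Ψ 1 V (v - h) = orliczConv Ψ 1 (fun y => V (y - h)) v := by
  simp only [orliczConv]
  refine lintegral_congr fun x => ?_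
  rw [sub_right_comm]

/-- Log-concavity of V says exactly that K(y) = V(y - h)/V(y) increases. The convolution of V(· - h)
is that of K V, so the monotone ratio for K is log-concavity of the convolution. -/
theorem IsShiftLogConcave.orliczConv (hΨ : IsYoungFunction Ψ) (hev : Function.Even Ψ)
    (hV : Monotone V) (hVfin : ∀ r, V r ≠ ∞) (hfin : ∀ r, orliczConv Ψ 1 V r ≠ ∞)
    (hlc : IsShiftLogConcave V) : IsShiftLogConcave (orliczConv Ψ 1 V) := by
  intro v v' h hh hv
  set K : ℝ → ℝ≥0∞ := fun y => V (y - h) / V y with hKdef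
  have hKV : ∀ y, V (y - h) = K y * V y := by
    intro y
    by_cases h0 : V y = 0
    · have : V (y - h) = 0 := le_antisymm (h0 ▸ hV (by linarith)) zero_le
      rw [h0, this, mul_zero]
    · rw [hKdef, ENNReal.div_mul_cancel h0 (hVfin y)]
  have hK : Monotone K := by
    intro y y' hy
    by_cases h0 : V y = 0
    · have : V (y - h) = 0 := le_antisymm (h0 ▸ hV (by linarith)) zero_le
      simp [hKdef, this]
    · have h0' : V y' ≠ 0 := fun h1 => h0 (le_antisymm (h1 ▸ hV hy) zero_le)
      simp only [hKdef]
      rw [ENNReal.div_le_iff h0 (hVfin y), div_eq_mul_inv, mul_right_comm, ← div_eq_mul_inv,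
        ENNReal.le_div_iff_mul_le (Or.inl h0') (Or.inl (hVfin y'))]
      exact hlc y y' h hh hy
  rw [orliczConv_one_shift, orliczConv_one_shift]
  simp only [hKV]
  exact orliczConv_mul_monotone_ratio hΨ hev hV hfin hK hv

/-- Log-concavity with shift Ψ x - Ψ y gives the inequality between the densities for x in U and y
outside; it is integrated over both. -/
theorem levelMeasure_mul_compl_le (hΨ : IsYoungFunction Ψ) (hV : Monotone V)
    (hlc : IsShiftLogConcave V) {U : Set ℝ} (hU : MeasurableSet U)
    (hUΨ : ∀ x ∈ U, ∀ y ∉ U, Ψ y ≤ Ψ x) {r r' : ℝ} (hr : r ≤ r') :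
    levelMeasure Ψ V r U * levelMeasure Ψ V r' Uᶜ
      ≤ levelMeasure Ψ V r' U * levelMeasure Ψ V r Uᶜ := by
  have hm := fun r => measurable_comp_level (V := V) hΨ hV.measurable r
  simp only [levelMeasure_apply hU, levelMeasure_apply hU.compl]
  rw [← lintegral_mul_const _ (hm r), ← lintegral_mul_const _ (hm r')]
  refine setLIntegral_mono' hU fun x hx => ?_
  rw [← lintegral_const_mul _ (hm r'), ← lintegral_const_mul _ (hm r)]
  refine setLIntegral_mono' hU.compl fun y hy => ?_
  have h := hlc (r - Ψ y) (r' - Ψ y) (Ψ x - Ψ y) (by linarith [hUΨ x hx y hy]) (by linarith)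
  simpa only [sub_sub_sub_cancel_right] using
    (by convert h using 3 <;> ring : V (r - Ψ x) * V (r' - Ψ y) ≤ V (r' - Ψ x) * V (r - Ψ y))

/-- The set is an annulus: U keeps away from the origin and S bounds Ψ from above. If it is nonempty
at level r, its complement is the disjoint union of an inner and an outer part. Both lose proportion
as the level rises, the inner by log-concavity and the outer by the contraction, so the annulus
gains. -/
theorem levelMeasure_inter_mul_le (hΨ : IsYoungFunction Ψ) (hev : Function.Even Ψ)
    (hV : Monotone V) (hlc : IsShiftLogConcave V) (hfin : ∀ r, orliczConv Ψ 1 V r ≠ ∞)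
    {U S : Set ℝ} (hU : MeasurableSet U) (hUΨ : ∀ x ∈ U, ∀ y ∉ U, Ψ y < Ψ x)
    (hS : IsUpperSet S) {r r' : ℝ} (hr : r ≤ r') :
    levelMeasure Ψ V r (U ∩ {x | r - Ψ x ∈ S}) * levelMeasure Ψ V r' univ
      ≤ levelMeasure Ψ V r' (U ∩ {x | r' - Ψ x ∈ S}) * levelMeasure Ψ V r univ := by
  rcases eq_empty_or_nonempty (U ∩ {x | r - Ψ x ∈ S}) with h0 | ⟨x₀, hx₀U, hx₀S⟩
  · simp [h0]
  have hcov : ∀ s, r ≤ s → ∀ y, y ∉ U → y ∈ {x | s - Ψ x ∈ S} := by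
    intro s hs y hy
    have := hUΨ x₀ hx₀U y hy
    exact hS (by linarith) hx₀S
  have hdec : ∀ s, r ≤ s → levelMeasure Ψ V s univ
      = levelMeasure Ψ V s (U ∩ {x | s - Ψ x ∈ S}) + levelMeasure Ψ V s Uᶜ
        + levelMeasure Ψ V s {x | s - Ψ x ∈ S}ᶜ := by
    intro s hs
    have hSm := measurableSet_level hΨ hS s
    rw [← measure_add_measure_compl hSm]
    congr 1
    rw [← measure_inter_add_sdiff {x | s - Ψ x ∈ S} hU, inter_comm]
    congr 2
    ext y
    exact ⟨fun h => h.2, fun h => ⟨hcov s hs y h, h⟩⟩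
  have hne : ∀ s (A : Set ℝ), levelMeasure Ψ V s A ≠ ∞ := fun s A =>
    ne_top_of_le_ne_top (levelMeasure_univ (Ψ := Ψ) (V := V) s ▸ hfin s) (measure_mono (subset_univ A))
  have hC : levelMeasure Ψ V r' Uᶜ * levelMeasure Ψ V r univ
      ≤ levelMeasure Ψ V r Uᶜ * levelMeasure Ψ V r' univ := by
    rw [← measure_add_measure_compl (μ := levelMeasure Ψ V r) hU,
      ← measure_add_measure_compl (μ := levelMeasure Ψ V r') hU, mul_add, mul_add]
    refine add_le_add ?_ (mul_comm _ _).le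
    have := levelMeasure_mul_compl_le hΨ hV hlc hU (fun x hx y hy => (hUΨ x hx y hy).le) hr
    rwa [mul_comm, mul_comm (levelMeasure Ψ V r Uᶜ)]
  have hR : levelMeasure Ψ V r' {x | r' - Ψ x ∈ S}ᶜ * levelMeasure Ψ V r univ
      ≤ levelMeasure Ψ V r {x | r - Ψ x ∈ S}ᶜ * levelMeasure Ψ V r' univ := by
    rw [← measure_add_measure_compl (μ := levelMeasure Ψ V r) (measurableSet_level hΨ hS r),
      ← measure_add_measure_compl (μ := levelMeasure Ψ V r') (measurableSet_level hΨ hS r'),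
      mul_add, mul_add]
    refine add_le_add ?_ (mul_comm _ _).le
    exact mul_le_mul' (levelMeasure_compl_level_le hΨ hev hV.measurable hS hr
      (hS (by linarith [hΨ.nonneg x₀]) hx₀S)) (levelMeasure_level_mono hΨ hV hS hr)
  set Z := levelMeasure Ψ V r univ
  set Z' := levelMeasure Ψ V r' univ
  have h := calc
    levelMeasure Ψ V r (U ∩ {x | r - Ψ x ∈ S}) * Z'
        + (levelMeasure Ψ V r Uᶜ * Z' + levelMeasure Ψ V r {x | r - Ψ x ∈ S}ᶜ * Z')
        = Z * Z' := by rw [← add_assoc, ← add_mul, ← add_mul, ← hdec r le_rfl]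
    _ = Z' * Z := mul_comm _ _
    _ = levelMeasure Ψ V r' (U ∩ {x | r' - Ψ x ∈ S}) * Z
        + (levelMeasure Ψ V r' Uᶜ * Z + levelMeasure Ψ V r' {x | r' - Ψ x ∈ S}ᶜ * Z) := by
        rw [← add_assoc, ← add_mul, ← add_mul, ← hdec r' hr]
    _ ≤ levelMeasure Ψ V r' (U ∩ {x | r' - Ψ x ∈ S}) * Z
        + (levelMeasure Ψ V r Uᶜ * Z' + levelMeasure Ψ V r {x | r - Ψ x ∈ S}ᶜ * Z') := by
        gcongr
  refine (ENNReal.add_le_add_iff_right ?_).1 h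
  exact ENNReal.add_ne_top.2 ⟨ENNReal.mul_ne_top (hne _ _) (hne _ _),
    ENNReal.mul_ne_top (hne _ _) (hne _ _)⟩

/-- Weighting by an increasing function of `|x|` preserves monotonicity of the ratio to the
unweighted convolution. -/
theorem orliczConv_monotone_ratio (hΨ : IsYoungFunction Ψ) (hev : Function.Even Ψ)
    (hV : Monotone V) (hVfin : ∀ r, V r ≠ ∞) (hlc : IsShiftLogConcave V)
    (hfin : ∀ r, orliczConv Ψ 1 V r ≠ ∞) {N : ℝ → ℝ≥0∞} (hN0 : ∀ r, V r = 0 → N r = 0)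
    (hNV : ∀ r r', r ≤ r' → N r * V r' ≤ N r' * V r) {f : ℝ → ℝ≥0∞} (hf : Measurable f)
    (hfm : ∀ x y, |x| ≤ |y| → f x ≤ f y) {r r' : ℝ} (hr : r ≤ r') :
    orliczConv Ψ f N r * orliczConv Ψ 1 V r' ≤ orliczConv Ψ f N r' * orliczConv Ψ 1 V r := by
  obtain ⟨K, hKdef⟩ : ∃ K : ℝ → ℝ≥0∞, K = fun y => N y / V y := ⟨_, rfl⟩
  have hKV : N = fun y => K y * V y := by
    ext y
    by_cases h0 : V y = 0
    · rw [h0, hN0 y h0, mul_zero]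
    · rw [hKdef, ENNReal.div_mul_cancel h0 (hVfin y)]
  have hK : Monotone K := by
    intro y y' hy
    by_cases h0 : V y = 0
    · simp [hKdef, hN0 y h0]
    · have h0' : V y' ≠ 0 := fun h1 => h0 (le_antisymm (h1 ▸ hV hy) (zero_le))
      simp only [hKdef]
      rw [ENNReal.div_le_iff h0 (hVfin y), div_eq_mul_inv, mul_right_comm, ← div_eq_mul_inv,
        ENNReal.le_div_iff_mul_le (Or.inl h0') (Or.inl (hVfin y'))]
      exact hNV y y' hy
  -- Layer cake in both factors: superlevel sets of f play the role of U, those of K the role of S.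
  rw [hKV, orliczConv_mul_eq hΨ hV.measurable hf hK.measurable,
    orliczConv_mul_eq hΨ hV.measurable hf hK.measurable,
    lintegral_mul_eq_lintegral_measure_inter _ hf (measurable_comp_level hΨ hK.measurable r),
    lintegral_mul_eq_lintegral_measure_inter _ hf (measurable_comp_level hΨ hK.measurable r'),
    ← lintegral_mul_const' _ _ (hfin _), ← lintegral_mul_const' _ _ (hfin _)]
  refine lintegral_mono fun t => ?_
  simp only []
  rw [← lintegral_mul_const' _ _ (hfin _), ← lintegral_mul_const' _ _ (hfin _)]
  refine lintegral_mono fun s => ?_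
  rw [← levelMeasure_univ, ← levelMeasure_univ]
  refine levelMeasure_inter_mul_le hΨ hev hV hlc hfin (measurableSet_lt measurable_const hf) ?_
    (isUpperSet_lt_of_monotone hK _) hr
  intro x hx y hy
  by_contra h
  exact hy (lt_of_lt_of_le hx (hfm x y ((hΨ.le_iff_abs_le hev).1 (not_lt.1 h))))

/-- Chebyshev's association inequality for an increasing weight and a ratio which increases with
the remaining level. -/
theorem orliczConv_chebyshev (hΨ : IsYoungFunction Ψ) (hev : Function.Even Ψ)
    (hV : Measurable V) {N : ℝ → ℝ≥0∞} (hN : Measurable N)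
    (hNV : ∀ r r', r ≤ r' → N r * V r' ≤ N r' * V r) {f : ℝ → ℝ≥0∞} (hf : Measurable f)
    (hfm : ∀ x y, |x| ≤ |y| → f x ≤ f y) (r : ℝ) :
    orliczConv Ψ f N r * orliczConv Ψ 1 V r ≤ orliczConv Ψ f V r * orliczConv Ψ 1 N r := by
  have hv := measurable_comp_level hΨ hV r
  have hn := measurable_comp_level hΨ hN r
  -- Doubling symmetrises the product in (x, y), so that the comparison becomes pointwise.
  have two : ∀ A B : ℝ → ℝ≥0∞, Measurable A → Measurable B →
      2 * (orliczConv Ψ f A r * orliczConv Ψ 1 B r)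
        = ∫⁻ x, ∫⁻ y, (f x * A (r - Ψ x) * B (r - Ψ y) + f y * A (r - Ψ y) * B (r - Ψ x)) := by
    intro A B hA hB
    have ha := measurable_comp_level hΨ hA r
    have hb := measurable_comp_level hΨ hB r
    simp only [orliczConv, Pi.one_apply, one_mul]
    have hF : Measurable fun x => f x * A (r - Ψ x) := hf.mul ha
    have h1 : ∀ x, ∫⁻ y, (f x * A (r - Ψ x) * B (r - Ψ y) + f y * A (r - Ψ y) * B (r - Ψ x))
        = f x * A (r - Ψ x) * (∫⁻ y, B (r - Ψ y))
          + (∫⁻ y, f y * A (r - Ψ y)) * B (r - Ψ x) := by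
      intro x
      rw [lintegral_add_left (hb.const_mul _), lintegral_const_mul _ hb, lintegral_mul_const _ hF]
    simp only [h1]
    rw [lintegral_add_left (hF.mul_const _), lintegral_mul_const _ hF, lintegral_const_mul _ hb,
      two_mul]
  rw [← ENNReal.mul_le_mul_iff_right (a := 2) (by norm_num) (by norm_num), two N V hN hV,
    two V N hV hN]
  -- Rearrangement without subtraction: with b = a + d and p = q + e the two sides differ by d e.
  have aux : ∀ a b p q : ℝ≥0∞, a ≤ b → q ≤ p → a * p + b * q ≤ a * q + b * p := by
    intro a b p q hab hqp
    obtain ⟨d, rfl⟩ := exists_add_of_le hab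
    obtain ⟨e, rfl⟩ := exists_add_of_le hqp
    calc _ ≤ a * (q + e) + (a + d) * q + d * e := le_self_add
      _ = _ := by ring
  refine lintegral_mono fun x => lintegral_mono fun y => ?_
  simp only [mul_assoc]
  rw [mul_comm (V (r - Ψ x)), mul_comm (V (r - Ψ y))]
  rcases le_total |x| |y| with h | h
  · exact aux _ _ _ _ (hfm x y h)
      (hNV _ _ (by linarith [(hΨ.le_iff_abs_le hev).2 h]))
  · rw [add_comm, add_comm (f x * _)]
    exact aux _ _ _ _ (hfm y x h)
      (hNV _ _ (by linarith [(hΨ.le_iff_abs_le hev).2 h]))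

end Level

/-- The integral of `∏ fᵢ (xᵢ)` over the Orlicz ball `∑ Ψ (xᵢ) ≤ r`, as an iterated integral. -/
noncomputable def orliczIter (Ψ : ℝ → ℝ) : List (ℝ → ℝ≥0∞) → ℝ → ℝ≥0∞
  | [] => (Ici 0).indicator 1
  | f :: l => orliczConv Ψ f (orliczIter Ψ l)

/-- The volume of the `m`-dimensional Orlicz ball of level `r`. -/
noncomputable def orliczVolume (Ψ : ℝ → ℝ) (m : ℕ) : ℝ → ℝ≥0∞ :=
  orliczIter Ψ (List.replicate m 1)

/-! ### Orlicz balls of any dimension and negative association. -/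

section Iter

variable {Ψ : ℝ → ℝ}

theorem orliczVolume_succ (m : ℕ) : orliczVolume Ψ (m + 1) = orliczConv Ψ 1 (orliczVolume Ψ m) :=
  rfl

theorem orliczIter_monotone (l : List (ℝ → ℝ≥0∞)) : Monotone (orliczIter Ψ l) := by
  induction l with
  | nil =>
    intro r r' h
    by_cases h0 : 0 ≤ r
    · simp [orliczIter, h0, h0.trans h]
    · simp [orliczIter, h0]
  | cons f l ih => exact fun r r' h => lintegral_mono fun x => mul_le_mul_right (ih (by linarith)) _

theorem orliczIter_of_neg (hΨ : IsYoungFunction Ψ) (l : List (ℝ → ℝ≥0∞)) {r : ℝ} (hr : r < 0) :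
    orliczIter Ψ l r = 0 := by
  induction l generalizing r with
  | nil => exact indicator_of_notMem (by simpa using hr) _
  | cons f l ih =>
    simp only [orliczIter, orliczConv]
    rw [lintegral_eq_zero_of_ae_eq_zero]
    exact Eventually.of_forall fun x => by simp [ih (show r - Ψ x < 0 by linarith [hΨ.nonneg x])]

theorem orliczConv_le (hΨ : IsYoungFunction Ψ) {W : ℝ → ℝ≥0∞} (hW : Monotone W)
    (hneg : ∀ r < 0, W r = 0) (f : ℝ → ℝ≥0∞) (hf : Measurable f) (r : ℝ) :
    orliczConv Ψ f W r ≤ (∫⁻ x in {x | Ψ x ≤ r}, f x) * W r := by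
  have hm : MeasurableSet {x | Ψ x ≤ r} := measurableSet_le hΨ.continuous.measurable measurable_const
  rw [← lintegral_mul_const _ hf, ← lintegral_indicator hm]
  refine lintegral_mono fun x => ?_
  by_cases hx : Ψ x ≤ r
  · rw [indicator_of_mem (by exact hx)]
    exact mul_le_mul_right (hW (by linarith [hΨ.nonneg x])) _
  · simp [hneg (r - Ψ x) (by linarith)]

theorem volume_level_lt_top (hΨ : IsYoungFunction Ψ) (hev : Function.Even Ψ) (r : ℝ) :
    volume {x | Ψ x ≤ r} < ∞ := by
  obtain ⟨R, -, hR⟩ := hΨ.exists_abs_le hev r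
  refine lt_of_le_of_lt (measure_mono (t := Icc (-R) R) fun x hx => abs_le.1 (hR x hx)) ?_
  simp

theorem orliczVolume_ne_top (hΨ : IsYoungFunction Ψ) (hev : Function.Even Ψ) (m : ℕ) (r : ℝ) :
    orliczVolume Ψ m r ≠ ∞ := by
  induction m with
  | zero =>
    by_cases h : r ∈ Ici (0 : ℝ) <;> simp [orliczVolume, orliczIter, h]
  | succ m ih =>
    refine ne_top_of_le_ne_top ?_ (orliczConv_le hΨ (orliczIter_monotone _)
      (fun r hr => orliczIter_of_neg hΨ _ hr) 1 measurable_one r)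
    refine ENNReal.mul_ne_top ?_ ih
    simpa using (volume_level_lt_top hΨ hev r).ne

theorem orliczVolume_pos (hΨ : IsYoungFunction Ψ) (m : ℕ) {r : ℝ} (hr : 0 < r) :
    0 < orliczVolume Ψ m r := by
  induction m generalizing r with
  | zero => simp [orliczVolume, orliczIter, hr.le]
  | succ m ih =>
    rw [orliczVolume_succ, orliczConv]
    have hm : Measurable fun x => orliczVolume Ψ m (r - Ψ x) :=
      measurable_comp_level hΨ (orliczIter_monotone _).measurable r
    simp only [Pi.one_apply, one_mul]
    rw [lintegral_pos_iff_support hm]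
    have ho : IsOpen {x | Ψ x < r} := isOpen_lt hΨ.continuous continuous_const
    refine lt_of_lt_of_le (ho.measure_pos volume ⟨0, by simpa [hΨ.map_zero] using hr⟩)
      (measure_mono fun x hx => ?_)
    exact (ih (sub_pos.2 hx)).ne'

theorem orliczVolume_isShiftLogConcave (hΨ : IsYoungFunction Ψ) (hev : Function.Even Ψ) (m : ℕ) :
    IsShiftLogConcave (orliczVolume Ψ m) := by
  induction m with
  | zero =>
    intro v v' h hh hv
    simp only [orliczVolume, List.replicate_zero, orliczIter, indicator, mem_Ici, Pi.one_apply]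
    split_ifs <;> first | (exfalso; linarith) | simp
  | succ m ih =>
    exact ih.orliczConv hΨ hev (orliczIter_monotone _) (orliczVolume_ne_top hΨ hev m)
      (orliczVolume_ne_top hΨ hev (m + 1))

/-- Ensures that dividing an iterated integral by the volume and multiplying back loses nothing
where the volume is 0. -/
theorem orliczIter_eq_zero_of_volume (hΨ : IsYoungFunction Ψ) (l : List (ℝ → ℝ≥0∞)) {r : ℝ}
    (h : orliczVolume Ψ l.length r = 0) : orliczIter Ψ l r = 0 := by
  induction l generalizing r with
  | nil => exact h
  | cons f l ih =>
    rw [List.length_cons, orliczVolume_succ, orliczConv, lintegral_eq_zero_iff] at h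
    · refine lintegral_eq_zero_of_ae_eq_zero ?_
      filter_upwards [h] with x hx
      simp only [Pi.one_apply, one_mul, Pi.zero_apply] at hx ⊢
      rw [ih hx, mul_zero]
    · exact measurable_one.mul (measurable_comp_level hΨ (orliczIter_monotone _).measurable r)

/-- The mean of a product of increasing functions of the `|xᵢ|` over the ball of level `r` increases
with `r`. -/
theorem orliczIter_monotone_ratio (hΨ : IsYoungFunction Ψ) (hev : Function.Even Ψ)
    (l : List (ℝ → ℝ≥0∞)) (hl : ∀ f ∈ l, Measurable f ∧ ∀ x y, |x| ≤ |y| → f x ≤ f y)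
    (r r' : ℝ) (hr : r ≤ r') :
    orliczIter Ψ l r * orliczVolume Ψ l.length r'
      ≤ orliczIter Ψ l r' * orliczVolume Ψ l.length r := by
  induction l generalizing r r' with
  | nil => exact (mul_comm _ _).le
  | cons f l ih =>
    obtain ⟨hf, hfm⟩ := hl f (by simp)
    exact orliczConv_monotone_ratio hΨ hev (orliczIter_monotone _)
      (orliczVolume_ne_top hΨ hev _) (orliczVolume_isShiftLogConcave hΨ hev _)
      (orliczVolume_ne_top hΨ hev (l.length + 1)) (fun r => orliczIter_eq_zero_of_volume hΨ l)
      (ih fun g hg => hl g (by simp [hg])) hf hfm hr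

theorem orliczConv_comm (hΨ : IsYoungFunction Ψ) {f g W : ℝ → ℝ≥0∞} (hf : Measurable f)
    (hg : Measurable g) (hW : Measurable W) :
    orliczConv Ψ f (orliczConv Ψ g W) = orliczConv Ψ g (orliczConv Ψ f W) := by
  ext r
  have hc := hΨ.continuous.measurable
  simp only [orliczConv]
  have h : ∀ (f g : ℝ → ℝ≥0∞), Measurable g → ∀ x, f x * ∫⁻ y, g y * W (r - Ψ x - Ψ y)
      = ∫⁻ y, f x * (g y * W (r - Ψ x - Ψ y)) := by
    intro f g hg x
    rw [lintegral_const_mul]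
    fun_prop
  simp only [h f g hg, h g f hf]
  rw [lintegral_lintegral_swap]
  · refine lintegral_congr fun y => lintegral_congr fun x => ?_
    rw [sub_right_comm]; ring
  · refine Measurable.aemeasurable ?_
    simp only [Function.uncurry_def]
    fun_prop

theorem orliczIter_perm (hΨ : IsYoungFunction Ψ) {l l' : List (ℝ → ℝ≥0∞)} (h : l.Perm l')
    (hl : ∀ f ∈ l, Measurable f) : orliczIter Ψ l = orliczIter Ψ l' := by
  induction h with
  | nil => rfl
  | cons f _ ih => simp only [orliczIter, ih fun g hg => hl g (by simp [hg])]
  | swap f g l =>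
    exact orliczConv_comm hΨ (hl g (by simp)) (hl f (by simp)) (orliczIter_monotone l).measurable
  | trans h1 _ ih1 ih2 => rw [ih1 hl, ih2 fun g hg => hl g (h1.mem_iff.2 hg)]

/-- Negative association of the absolute values of the coordinates, for products of increasing
functions of single coordinates. -/
theorem orliczIter_negative_association (hΨ : IsYoungFunction Ψ) (hev : Function.Even Ψ)
    (l : List (ℝ → ℝ≥0∞)) (hl : ∀ f ∈ l, Measurable f ∧ ∀ x y, |x| ≤ |y| → f x ≤ f y)
    (m n : ℕ) (hn : l.length + m = n + 1) (r : ℝ) :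
    orliczIter Ψ (l ++ List.replicate m 1) r * orliczVolume Ψ (n + 1) r ^ l.length
      ≤ (l.map fun f => orliczConv Ψ f (orliczVolume Ψ n) r).prod * orliczVolume Ψ (n + 1) r := by
  induction l generalizing m with
  | nil =>
    simp only [List.length_nil, zero_add] at hn
    simp [hn, orliczVolume]
  | cons f l ih =>
    obtain ⟨hf, hfm⟩ := hl f (by simp)
    have hl' : ∀ g ∈ l, Measurable g ∧ ∀ x y, |x| ≤ |y| → g x ≤ g y := fun g hg => hl g (by simp [hg])
    have hn' : l.length + m = n := by simp only [List.length_cons] at hn; omega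
    have hA : ∀ g ∈ l ++ List.replicate m 1, Measurable g ∧ ∀ x y, |x| ≤ |y| → g x ≤ g y := by
      intro g hg
      rcases List.mem_append.1 hg with hg | hg
      · exact hl' g hg
      · rw [List.eq_of_mem_replicate hg]
        exact ⟨measurable_one, fun _ _ _ => le_rfl⟩
    have hratio := orliczIter_monotone_ratio hΨ hev _ hA
    rw [List.length_append, List.length_replicate, hn'] at hratio
    -- The first factor splits off; its coordinate now carries the weight 1. Moving that 1 to the
    -- end adds it to the padding, which keeps the dimension n + 1 throughout the induction.
    have hcheb := orliczConv_chebyshev hΨ hev (V := orliczVolume Ψ n)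
      (orliczIter_monotone _).measurable (orliczIter_monotone (l ++ List.replicate m 1)).measurable
      hratio hf hfm r
    have hcomm : orliczConv Ψ 1 (orliczIter Ψ (l ++ List.replicate m 1))
        = orliczIter Ψ (l ++ List.replicate (m + 1) 1) := by
      refine orliczIter_perm (l := 1 :: (l ++ List.replicate m 1)) hΨ ?_ ?_
      · rw [List.replicate_succ]; exact List.perm_middle.symm
      · intro g hg
        rcases List.mem_cons.1 hg with rfl | hg
        · exact measurable_one
        · exact (hA g hg).1
    rw [hcomm] at hcheb
    have hih := ih hl' (m + 1) (by omega)
    calc orliczIter Ψ (f :: l ++ List.replicate m 1) r * orliczVolume Ψ (n + 1) r ^ (f :: l).length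
        = (orliczConv Ψ f (orliczIter Ψ (l ++ List.replicate m 1)) r
            * orliczConv Ψ 1 (orliczVolume Ψ n) r) * orliczVolume Ψ (n + 1) r ^ l.length := by
          rw [List.length_cons, pow_succ', ← mul_assoc]; rfl
      _ ≤ (orliczConv Ψ f (orliczVolume Ψ n) r * orliczIter Ψ (l ++ List.replicate (m + 1) 1) r)
            * orliczVolume Ψ (n + 1) r ^ l.length := by gcongr
      _ ≤ orliczConv Ψ f (orliczVolume Ψ n) r *
            ((l.map fun f => orliczConv Ψ f (orliczVolume Ψ n) r).prod
              * orliczVolume Ψ (n + 1) r) := by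
          rw [mul_assoc]; gcongr
      _ = _ := by rw [List.map_cons, List.prod_cons, mul_assoc]

end Iter

/-! ### Monotonicity of product densities along circles. -/

section Circle

variable {Ψ : ℝ → ℝ}

/-- The endpoint matters because points on the coordinate axes have a zero squared coordinate. -/
theorem convexOn_Ici_of_convexOn_Ioi {f : ℝ → ℝ} (hf : ConvexOn ℝ (Ioi 0) f) (hc : Continuous f) :
    ConvexOn ℝ (Ici 0) f := by
  refine ⟨convex_Ici 0, fun x hx y hy a b ha hb hab => ?_⟩
  have hl : Tendsto (fun ε : ℝ => f (a • (x + ε) + b • (y + ε))) (𝓝[>] 0) (𝓝 (f (a • x + b • y))) := by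
    have : Continuous fun ε : ℝ => f (a • (x + ε) + b • (y + ε)) := by fun_prop
    simpa using (this.tendsto 0).mono_left nhdsWithin_le_nhds
  have hr : Tendsto (fun ε : ℝ => a • f (x + ε) + b • f (y + ε)) (𝓝[>] 0)
      (𝓝 (a • f x + b • f y)) := by
    have : Continuous fun ε : ℝ => a • f (x + ε) + b • f (y + ε) := by fun_prop
    simpa using (this.tendsto 0).mono_left nhdsWithin_le_nhds
  refine le_of_tendsto_of_tendsto hl hr ?_
  filter_upwards [self_mem_nhdsWithin] with ε hε
  have hε' : 0 < ε := hε
  have hx' : 0 ≤ x := hx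
  have hy' : 0 ≤ y := hy
  exact hf.2 (show x + ε ∈ Ioi (0 : ℝ) from by simp only [mem_Ioi]; linarith)
    (show y + ε ∈ Ioi (0 : ℝ) from by simp only [mem_Ioi]; linarith) ha hb hab

/-- Two-point Karamata: s and t are convex combinations of s' and t' with exchanged weights. -/
theorem ConvexOn.add_le_add_of_between {f : ℝ → ℝ} {D : Set ℝ} (hf : ConvexOn ℝ D f)
    {s' s t t' : ℝ} (hs' : s' ∈ D) (ht' : t' ∈ D) (h1 : s' ≤ s) (h2 : s ≤ t')
    (hsum : s + t = s' + t') : f s + f t ≤ f s' + f t' := by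
  rcases (h1.trans h2).eq_or_lt with h | h
  · have e1 : s = s' := le_antisymm (h ▸ h2) h1
    have e2 : t = t' := by linarith
    rw [e1, e2]
  · set a := (t' - s) / (t' - s') with ha
    set b := (s - s') / (t' - s') with hb
    have hd : 0 < t' - s' := sub_pos.2 h
    have ha0 : 0 ≤ a := div_nonneg (sub_nonneg.2 h2) hd.le
    have hb0 : 0 ≤ b := div_nonneg (sub_nonneg.2 h1) hd.le
    have hab : a + b = 1 := by rw [ha, hb]; field_simp; ring
    have e1 : a • s' + b • t' = s := by simp only [ha, hb, smul_eq_mul]; field_simp; ring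
    have e2 : b • s' + a • t' = t := by
      have : t = s' + t' - s := by linarith
      rw [this]; simp only [ha, hb, smul_eq_mul]; field_simp; ring
    have i1 := hf.2 hs' ht' ha0 hb0 hab
    have i2 := hf.2 hs' ht' hb0 ha0 (by rw [add_comm]; exact hab)
    rw [e1] at i1
    rw [e2] at i2
    simp only [smul_eq_mul] at i1 i2
    have : a * f s' + b * f t' + (b * f s' + a * f t') = (a + b) * (f s' + f t') := by ring
    rw [hab, one_mul] at this
    linarith

theorem IsShiftLogConcave.mul_le_mul {V : ℝ → ℝ≥0∞} (hlc : IsShiftLogConcave V) (hV : Monotone V)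
    {p p' q q' : ℝ} (hpq' : p ≤ q') (hqq' : q ≤ q') (hsum : p' + q' ≤ p + q) :
    V p' * V q' ≤ V p * V q := by
  have h := hlc q q' (q' - p) (sub_nonneg.2 hpq') hqq'
  rw [sub_sub_cancel] at h
  exact (mul_le_mul_left (hV (by linarith)) _).trans h

/-- The density `x ↦ V (1 - Ψ x)` makes the product density on the plane increase along circles
towards the diagonals. -/
theorem level_mul_le_of_circle (hΨ : IsYoungFunction Ψ) (hev : Function.Even Ψ)
    (hsq : ConvexOn ℝ (Ioi 0) (fun t : ℝ => Ψ (Real.sqrt t))) {V : ℝ → ℝ≥0∞} (hV : Monotone V)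
    (hlc : IsShiftLogConcave V) (r : ℝ) {x y x' y' : ℝ} (hc : x ^ 2 + y ^ 2 = x' ^ 2 + y' ^ 2)
    (hd : |x ^ 2 - y ^ 2| ≤ |x' ^ 2 - y' ^ 2|) :
    V (r - Ψ x') * V (r - Ψ y') ≤ V (r - Ψ x) * V (r - Ψ y) := by
  have hcv := convexOn_Ici_of_convexOn_Ioi hsq (hΨ.continuous.comp Real.continuous_sqrt)
  wlog hxy : y ^ 2 ≤ x ^ 2 generalizing x y
  · rw [mul_comm (V (r - Ψ x))]
    exact this (by linarith) (by rwa [abs_sub_comm]) (not_le.1 hxy).le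
  wlog hxy' : y' ^ 2 ≤ x' ^ 2 generalizing x' y'
  · rw [mul_comm (V (r - Ψ x'))]
    exact this (by linarith) (by rwa [abs_sub_comm (y' ^ 2)]) (not_le.1 hxy').le
  rw [abs_of_nonneg (sub_nonneg.2 hxy), abs_of_nonneg (sub_nonneg.2 hxy')] at hd
  -- The squares have equal sums and y'² ≤ y² ≤ x² ≤ x'², so Ψ x + Ψ y ≤ Ψ x' + Ψ y'.
  have h := hcv.add_le_add_of_between (s' := y' ^ 2) (s := y ^ 2) (t := x ^ 2) (t' := x' ^ 2)
    (mem_Ici.2 (sq_nonneg _)) (mem_Ici.2 (sq_nonneg _)) (by linarith) (by linarith) (by linarith)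
  simp only [Real.sqrt_sq_eq_abs, IsYoungFunction.apply_abs hev] at h
  have hm : ∀ u v : ℝ, u ^ 2 ≤ v ^ 2 → Ψ u ≤ Ψ v := fun u v huv =>
    (hΨ.le_iff_abs_le hev).2 (sq_le_sq.1 huv)
  refine hlc.mul_le_mul hV ?_ ?_ (by linarith)
  · linarith [hm y' x (by linarith)]
  · linarith [hm y' y (by linarith)]

end Circle

/-! ### Log-concavity of normalised even moments. -/

section Moments

/-- Exhibits the angular kernel as half the derivative of a periodic function, so that its integral
over the circle is 0. -/
theorem hasDerivAt_angular (k : ℕ) (θ : ℝ) :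
    HasDerivAt (fun θ => (Real.cos θ * Real.sin θ) ^ (2 * k + 1)
        * (Real.cos θ ^ 2 - Real.sin θ ^ 2))
      (2 * ((Real.cos θ * Real.sin θ) ^ (2 * k) * ((2 * k + 1) * (Real.cos θ ^ 4 + Real.sin θ ^ 4) / 2
        - (2 * k + 3) * (Real.cos θ ^ 2 * Real.sin θ ^ 2)))) θ := by
  have hc := Real.hasDerivAt_cos θ
  have hs := Real.hasDerivAt_sin θ
  have h := ((hc.mul hs).pow (2 * k + 1)).mul ((hc.pow 2).sub (hs.pow 2))
  refine h.congr_deriv ?_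
  simp only [Pi.mul_apply, Pi.pow_apply, Pi.sub_apply, Nat.add_sub_cancel]
  push_cast
  ring

/-- The angular part of the planar moment comparison. -/
theorem integral_angular_nonpos (k : ℕ) {w : ℝ → ℝ} {w₀ : ℝ} (hw : Measurable w)
    (hwb : ∃ C, ∀ θ, |w θ| ≤ C)
    (h1 : ∀ θ, 1 / Real.sqrt (2 * k + 2) ≤ |Real.cos θ ^ 2 - Real.sin θ ^ 2| → w θ ≤ w₀)
    (h2 : ∀ θ, |Real.cos θ ^ 2 - Real.sin θ ^ 2| ≤ 1 / Real.sqrt (2 * k + 2) → w₀ ≤ w θ) :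
    ∫ θ in Ioo (-Real.pi) Real.pi, (Real.cos θ * Real.sin θ) ^ (2 * k)
      * ((2 * k + 1) * (Real.cos θ ^ 4 + Real.sin θ ^ 4) / 2
        - (2 * k + 3) * (Real.cos θ ^ 2 * Real.sin θ ^ 2)) * w θ ≤ 0 := by
  set D : ℝ → ℝ := fun θ => (Real.cos θ * Real.sin θ) ^ (2 * k)
      * ((2 * k + 1) * (Real.cos θ ^ 4 + Real.sin θ ^ 4) / 2
        - (2 * k + 3) * (Real.cos θ ^ 2 * Real.sin θ ^ 2)) with hD
  have hDc : Continuous D := by fun_prop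
  have hDi : IntegrableOn D (Ioo (-Real.pi) Real.pi) :=
    (hDc.integrableOn_Icc).mono_set Ioo_subset_Icc_self
  have hD0 : ∫ θ in Ioo (-Real.pi) Real.pi, D θ = 0 := by
    rw [← integral_Ioc_eq_integral_Ioo, ← intervalIntegral.integral_of_le (by linarith [Real.pi_pos])]
    have h := intervalIntegral.integral_eq_sub_of_hasDerivAt (a := -Real.pi) (b := Real.pi)
      (fun θ _ => hasDerivAt_angular k θ) ((hDc.const_mul 2).intervalIntegrable _ _)
    rw [intervalIntegral.integral_const_mul] at h
    simpa using h
  obtain ⟨C, hC⟩ := hwb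
  have hDw : IntegrableOn (fun θ => D θ * w θ) (Ioo (-Real.pi) Real.pi) :=
    hDi.mul_bdd (c := C) hw.aestronglyMeasurable (Eventually.of_forall hC)
  -- D has the sign of (2k + 2)(cos² θ - sin² θ)² - 1, which changes exactly at the threshold of
  -- `h1` and `h2`. Hence D (w - w₀) ≤ 0 pointwise.
  calc ∫ θ in Ioo (-Real.pi) Real.pi, D θ * w θ
      ≤ ∫ θ in Ioo (-Real.pi) Real.pi, D θ * w₀ := by
        refine integral_mono hDw (hDi.mul_const _) fun θ => ?_
        have hcs := Real.cos_sq_add_sin_sq θ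
        set c := Real.cos θ
        set s := Real.sin θ
        have hk : (0 : ℝ) < 2 * k + 2 := by positivity
        have hDeq : D θ = (c * s) ^ (2 * k) / 2 * ((2 * k + 2) * (c ^ 2 - s ^ 2) ^ 2 - 1) := by
          simp only [hD]
          have e : (1 : ℝ) = (c ^ 2 + s ^ 2) ^ 2 := by rw [hcs]; ring
          rw [show (2 * (k : ℝ) + 2) * (c ^ 2 - s ^ 2) ^ 2 - 1
            = (2 * (k : ℝ) + 2) * (c ^ 2 - s ^ 2) ^ 2 - (c ^ 2 + s ^ 2) ^ 2 by rw [← e]]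
          ring
        have hnn : 0 ≤ (c * s) ^ (2 * k) / 2 := by
          have := (even_two_mul k).pow_nonneg (c * s)
          positivity
        have hz : (1 / Real.sqrt (2 * k + 2)) ^ 2 = 1 / (2 * k + 2) := by
          rw [div_pow, Real.sq_sqrt hk.le, one_pow]
        simp only []
        rcases le_total (1 / Real.sqrt (2 * k + 2)) |c ^ 2 - s ^ 2| with h | h
        · refine mul_le_mul_of_nonneg_left (h1 θ h) ?_
          have := pow_le_pow_left₀ (by positivity) h 2
          rw [hz, sq_abs, div_le_iff₀ hk] at this
          rw [hDeq]
          exact mul_nonneg hnn (by linarith)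
        · refine mul_le_mul_of_nonpos_left (h2 θ h) ?_
          have := pow_le_pow_left₀ (abs_nonneg _) h 2
          rw [hz, sq_abs, le_div_iff₀ hk] at this
          rw [hDeq]
          exact mul_nonpos_of_nonneg_of_nonpos hnn (by linarith)
    _ = 0 := by rw [integral_mul_const, hD0, zero_mul]

/-- Log-concavity of the normalised even moments of a density whose planar square increases along
circles towards the diagonals. -/
theorem moment_log_concave {ρ : ℝ → ℝ} (hρm : Measurable ρ) (hρb : ∃ C, ∀ x, |ρ x| ≤ C)
    (hρi : ∀ j : ℕ, Integrable fun x => x ^ j * ρ x)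
    (hρ : ∀ x y x' y', x ^ 2 + y ^ 2 = x' ^ 2 + y' ^ 2 → |x ^ 2 - y ^ 2| ≤ |x' ^ 2 - y' ^ 2| →
      ρ x' * ρ y' ≤ ρ x * ρ y) (k : ℕ) :
    (2 * k + 1) * ((∫ x, x ^ (2 * k) * ρ x) * ∫ x, x ^ (2 * k + 4) * ρ x)
      ≤ (2 * k + 3) * (∫ x, x ^ (2 * k + 2) * ρ x) ^ 2 := by
  have hprod : ∀ i j : ℕ, Integrable fun p : ℝ × ℝ => (p.1 ^ i * ρ p.1) * (p.2 ^ j * ρ p.2) :=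
    fun i j => (hρi i).mul_prod (hρi j)
  have hval : ∀ i j : ℕ, ∫ p : ℝ × ℝ, (p.1 ^ i * ρ p.1) * (p.2 ^ j * ρ p.2)
      = (∫ x, x ^ i * ρ x) * ∫ x, x ^ j * ρ x := fun i j =>
    integral_prod_mul (μ := volume) (ν := volume) (fun x => x ^ i * ρ x) (fun x => x ^ j * ρ x)
  -- The difference of the two sides as a planar integral, symmetrised in the two variables.
  set G : ℝ × ℝ → ℝ := fun p => (p.1 * p.2) ^ (2 * k) * ((2 * k + 1) * (p.1 ^ 4 + p.2 ^ 4) / 2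
    - (2 * k + 3) * (p.1 ^ 2 * p.2 ^ 2)) * (ρ p.1 * ρ p.2) with hG
  have hGeq : G = fun p => (2 * k + 1) / 2 * ((p.1 ^ (2 * k + 4) * ρ p.1) * (p.2 ^ (2 * k) * ρ p.2))
      + (2 * k + 1) / 2 * ((p.1 ^ (2 * k) * ρ p.1) * (p.2 ^ (2 * k + 4) * ρ p.2))
      - (2 * k + 3) * ((p.1 ^ (2 * k + 2) * ρ p.1) * (p.2 ^ (2 * k + 2) * ρ p.2)) := by
    ext p; simp only [hG]; ring
  have hGint : ∫ p, G p = (2 * k + 1) * ((∫ x, x ^ (2 * k) * ρ x) * ∫ x, x ^ (2 * k + 4) * ρ x)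
      - (2 * k + 3) * (∫ x, x ^ (2 * k + 2) * ρ x) ^ 2 := by
    have gen : ∀ (A B C : ℝ × ℝ → ℝ) (a b : ℝ), Integrable A → Integrable B → Integrable C →
        ∫ p, (a * A p + a * B p - b * C p) = a * (∫ p, A p) + a * (∫ p, B p) - b * ∫ p, C p := by
      intro A B C a b hA hB hC
      rw [integral_sub (f := fun p => a * A p + a * B p)
        ((hA.const_mul a).add (hB.const_mul a)) (hC.const_mul b),
        integral_add (hA.const_mul a) (hB.const_mul a), integral_const_mul, integral_const_mul,
        integral_const_mul]
    rw [hGeq, gen _ _ _ _ _ (hprod _ _) (hprod _ _) (hprod _ _), hval, hval, hval]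
    ring
  suffices h : ∫ p, G p ≤ 0 by linarith
  rw [← integral_comp_polarCoord_symm, polarCoord_target]
  -- If this failed, the Bochner integral would be 0 by convention and the bound would hold anyway.
  by_cases hint : IntegrableOn (fun p : ℝ × ℝ => p.1 • G (polarCoord.symm p))
      (Ioi (0 : ℝ) ×ˢ Ioo (-Real.pi) Real.pi) (volume.prod volume)
  swap
  · exact (integral_undef hint).le
  rw [Measure.volume_eq_prod, setIntegral_prod _ hint]
  refine setIntegral_nonpos measurableSet_Ioi fun r hr => ?_
  have hr0 : 0 < r := hr
  obtain ⟨C, hC⟩ := hρb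
  set z := 1 / Real.sqrt (2 * k + 2) with hz
  have hz0 : 0 ≤ z := by positivity
  have hz1 : z ≤ 1 := by
    rw [hz, div_le_one (by positivity), Real.one_le_sqrt]
    have : (0 : ℝ) ≤ k := by positivity
    linarith
  -- (c₀, s₀) is the point of the unit circle with c₀² - s₀² = z, where the kernel changes sign; the
  -- density there serves as w₀.
  set c₀ := Real.sqrt ((1 + z) / 2) with hc₀
  set s₀ := Real.sqrt ((1 - z) / 2) with hs₀
  have hc₀2 : c₀ ^ 2 = (1 + z) / 2 := Real.sq_sqrt (by linarith)
  have hs₀2 : s₀ ^ 2 = (1 - z) / 2 := Real.sq_sqrt (by linarith)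
  have hd₀ : |(r * c₀) ^ 2 - (r * s₀) ^ 2| = r ^ 2 * z := by
    rw [mul_pow, mul_pow, hc₀2, hs₀2, abs_of_nonneg] <;> [ring; skip]
    nlinarith [sq_nonneg r]
  have hdθ : ∀ θ, |(r * Real.cos θ) ^ 2 - (r * Real.sin θ) ^ 2|
      = r ^ 2 * |Real.cos θ ^ 2 - Real.sin θ ^ 2| := by
    intro θ
    rw [mul_pow, mul_pow, ← mul_sub, abs_mul, abs_of_nonneg (sq_nonneg r)]
  have hsum : ∀ θ, (r * c₀) ^ 2 + (r * s₀) ^ 2 = (r * Real.cos θ) ^ 2 + (r * Real.sin θ) ^ 2 := by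
    intro θ
    rw [mul_pow, mul_pow, mul_pow, mul_pow, ← mul_add, ← mul_add, Real.cos_sq_add_sin_sq, hc₀2, hs₀2]
    ring
  have hang := integral_angular_nonpos k (w := fun θ => ρ (r * Real.cos θ) * ρ (r * Real.sin θ))
    (w₀ := ρ (r * c₀) * ρ (r * s₀)) (by fun_prop)
    ⟨C * C, fun θ => by rw [abs_mul]; gcongr <;> [exact (abs_nonneg _).trans (hC 0); exact hC _; exact hC _]⟩
    (fun θ h => hρ _ _ _ _ (hsum θ) (by rw [hd₀, hdθ]; gcongr))
    (fun θ h => hρ _ _ _ _ (hsum θ).symm (by rw [hd₀, hdθ]; gcongr))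
  have hcalc : ∀ θ, (r, θ).1 • G (polarCoord.symm (r, θ)) = r ^ (4 * k + 5) *
      ((Real.cos θ * Real.sin θ) ^ (2 * k) * ((2 * k + 1) * (Real.cos θ ^ 4 + Real.sin θ ^ 4) / 2
        - (2 * k + 3) * (Real.cos θ ^ 2 * Real.sin θ ^ 2))
        * (ρ (r * Real.cos θ) * ρ (r * Real.sin θ))) := by
    intro θ
    simp only [hG, polarCoord_symm_apply, smul_eq_mul]
    rw [show r * Real.cos θ * (r * Real.sin θ) = r ^ 2 * (Real.cos θ * Real.sin θ) by ring, mul_pow,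
      ← pow_mul, show 4 * k + 5 = 2 * (2 * k) + 5 by ring, pow_add]
    ring
  simp only [hcalc]
  rw [integral_const_mul]
  exact mul_nonpos_of_nonneg_of_nonpos (by positivity) hang

end Moments

/-! ### Exponential series of log-concave sequences. -/

section ExpSeries

/-- The exponential generating function of a sequence. -/
noncomputable def expSeries (c : ℕ → ℝ) (s : ℝ) : ℝ := ∑' k, c k * s ^ k / k.factorial

variable {c : ℕ → ℝ}

theorem expSeries_summable (hb : ∃ A B, ∀ k, |c k| ≤ A * B ^ k) (s : ℝ) :
    Summable fun k => ‖c k * s ^ k / k.factorial‖ := by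
  obtain ⟨A, B, h⟩ := hb
  refine Summable.of_nonneg_of_le (fun k => norm_nonneg _) (fun k => ?_)
    ((Real.summable_pow_div_factorial (B * |s|)).mul_left A)
  rw [Real.norm_eq_abs, abs_div, abs_mul, abs_pow, Nat.abs_cast, mul_pow, ← mul_div_assoc,
    ← mul_assoc]
  gcongr
  exact h k

theorem bound_shift (hb : ∃ A B, ∀ k, |c k| ≤ A * B ^ k) :
    ∃ A B, ∀ k, |c (k + 1)| ≤ A * B ^ k := by
  obtain ⟨A, B, h⟩ := hb
  exact ⟨A * B, B, fun k => (h (k + 1)).trans_eq (by ring)⟩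

theorem expSeries_hasDerivAt (hb : ∃ A B, ∀ k, |c k| ≤ A * B ^ k) (s : ℝ) :
    HasDerivAt (expSeries c) (expSeries (fun k => c (k + 1)) s) s := by
  set M := |s| + 1 with hM
  have hM0 : 0 ≤ M := by positivity
  have hterm : ∀ (k : ℕ) (y : ℝ), c (k + 1) * ((k + 1 : ℕ) * y ^ k) / (k + 1).factorial = c (k + 1) * y ^ k / k.factorial := by
    intro k y
    rw [Nat.factorial_succ]
    push_cast
    field_simp
  have hu : Summable fun k : ℕ => |c k| * (k * M ^ (k - 1)) / k.factorial := by
    rw [← summable_nat_add_iff 1]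
    refine (expSeries_summable (bound_shift hb) M).congr fun k => ?_
    rw [← hterm, Real.norm_eq_abs, abs_div, abs_mul, abs_mul, abs_pow, Nat.abs_cast, Nat.abs_cast,
      abs_of_nonneg hM0, Nat.add_sub_cancel]
  have h := hasDerivAt_tsum_of_isPreconnected (t := Metric.ball (0 : ℝ) M)
    (g := fun k y => c k * y ^ k / k.factorial) (g' := fun k y => c k * (k * y ^ (k - 1)) / k.factorial)
    (y₀ := s) (y := s) hu Metric.isOpen_ball (convex_ball _ _).isPreconnected
    (fun k y _ => ((hasDerivAt_pow k y).const_mul _).div_const _)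
    (fun k y hy => by
      rw [mem_ball_zero_iff, Real.norm_eq_abs] at hy
      rw [Real.norm_eq_abs, abs_div, abs_mul, abs_mul, abs_pow, Nat.abs_cast, Nat.abs_cast]
      gcongr)
    (by rw [mem_ball_zero_iff, Real.norm_eq_abs]; linarith)
    (expSeries_summable hb s).of_norm (by rw [mem_ball_zero_iff, Real.norm_eq_abs]; linarith)
  refine h.congr_deriv ?_
  have hs : Summable fun k : ℕ => c k * (k * s ^ (k - 1)) / k.factorial := by
    refine Summable.of_norm_bounded hu fun k => ?_
    rw [Real.norm_eq_abs, abs_div, abs_mul, abs_mul, abs_pow, Nat.abs_cast, Nat.abs_cast]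
    gcongr
    linarith
  rw [hs.tsum_eq_zero_add]
  simp only [Nat.cast_zero, zero_mul, mul_zero, zero_div, zero_add, Nat.add_sub_cancel, hterm]
  rfl

theorem expSeries_pos (hb : ∃ A B, ∀ k, |c k| ≤ A * B ^ k) (hc : ∀ k, 0 < c k) {s : ℝ}
    (hs : 0 ≤ s) : 0 < expSeries c s := by
  have h : c 0 * s ^ 0 / Nat.factorial 0 ≤ expSeries c s := (expSeries_summable hb s).of_norm.le_tsum 0
    fun k _ => div_nonneg (mul_nonneg (hc k).le (pow_nonneg hs k)) (Nat.cast_nonneg _)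
  simp only [pow_zero, mul_one, Nat.factorial_zero, Nat.cast_one, div_one] at h
  exact (hc 0).trans_le h

theorem ratio_antitone (hc : ∀ k, 0 < c k) (hlc : ∀ k, c k * c (k + 2) ≤ c (k + 1) ^ 2) :
    Antitone fun k => c (k + 1) / c k := by
  refine antitone_nat_of_succ_le fun k => ?_
  rw [div_le_div_iff₀ (hc _) (hc _), ← pow_two, mul_comm]
  exact hlc k

/-- The logarithmic derivative decreases. In the double series of the difference, the terms (k, j)
and (j, k) with j ≤ k add up to a multiple of (c_{k+1} c_j - c_{j+1} c_k)(s'^k s^j - s^k s'^j),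
whose first factor is nonpositive and second nonnegative. -/
theorem expSeries_deriv_ratio (hb : ∃ A B, ∀ k, |c k| ≤ A * B ^ k) (hc : ∀ k, 0 < c k)
    (hlc : ∀ k, c k * c (k + 2) ≤ c (k + 1) ^ 2) {s s' : ℝ} (hs : 0 ≤ s) (hss : s ≤ s') :
    expSeries (fun k => c (k + 1)) s' * expSeries c s
      ≤ expSeries (fun k => c (k + 1)) s * expSeries c s' := by
  have hb' := bound_shift hb
  have hprod : ∀ x y, Summable fun p : ℕ × ℕ =>
      (c (p.1 + 1) * x ^ p.1 / p.1.factorial) * (c p.2 * y ^ p.2 / p.2.factorial) := fun x y =>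
    summable_mul_of_summable_norm (f := fun k => c (k + 1) * x ^ k / k.factorial)
      (g := fun k => c k * y ^ k / k.factorial) (expSeries_summable hb' x) (expSeries_summable hb y)
  have hval : ∀ x y, expSeries (fun k => c (k + 1)) x * expSeries c y
      = ∑' p : ℕ × ℕ, (c (p.1 + 1) * x ^ p.1 / p.1.factorial) * (c p.2 * y ^ p.2 / p.2.factorial) := fun x y =>
    tsum_mul_tsum_of_summable_norm (f := fun k => c (k + 1) * x ^ k / k.factorial)
      (g := fun k => c k * y ^ k / k.factorial) (expSeries_summable hb' x) (expSeries_summable hb y)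
  set T : ℕ × ℕ → ℝ := fun p => (c (p.1 + 1) * s' ^ p.1 / p.1.factorial) * (c p.2 * s ^ p.2 / p.2.factorial)
    - (c (p.1 + 1) * s ^ p.1 / p.1.factorial) * (c p.2 * s' ^ p.2 / p.2.factorial) with hT
  have hTs : Summable T := (hprod s' s).sub (hprod s s')
  have hTs' : Summable fun p : ℕ × ℕ => T p.swap := (Equiv.prodComm ℕ ℕ).summable_iff.2 hTs
  have hTv : ∑' p, T p = expSeries (fun k => c (k + 1)) s' * expSeries c s
      - expSeries (fun k => c (k + 1)) s * expSeries c s' := by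
    rw [hval, hval, ← (hprod s' s).tsum_sub (hprod s s')]
  have hTv' : ∑' p : ℕ × ℕ, T p.swap = ∑' p, T p := (Equiv.prodComm ℕ ℕ).tsum_eq T
  have hkey : ∀ j k : ℕ, j ≤ k → T (k, j) + T (j, k) ≤ 0 := by
    intro j k hjk
    have h1 : c (k + 1) * c j ≤ c (j + 1) * c k :=
      (div_le_div_iff₀ (hc k) (hc j)).1 (ratio_antitone hc hlc hjk)
    have h2 : s ^ k * s' ^ j ≤ s' ^ k * s ^ j := by
      obtain ⟨i, rfl⟩ := Nat.exists_eq_add_of_le hjk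
      calc s ^ (j + i) * s' ^ j = (s ^ j * s' ^ j) * s ^ i := by ring
        _ ≤ (s ^ j * s' ^ j) * s' ^ i := by
            have : 0 ≤ s' := hs.trans hss
            gcongr
        _ = _ := by ring
    have e : T (k, j) + T (j, k)
        = (c (k + 1) * c j - c (j + 1) * c k) * (s' ^ k * s ^ j - s ^ k * s' ^ j) / (k.factorial * j.factorial) := by
      simp only [hT]
      field_simp
      ring
    rw [e]
    exact div_nonpos_of_nonpos_of_nonneg
      (mul_nonpos_of_nonpos_of_nonneg (sub_nonpos.2 h1) (sub_nonneg.2 h2)) (by positivity)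
  have hsum : ∑' p : ℕ × ℕ, (T p + T p.swap) ≤ 0 := by
    refine tsum_nonpos fun p => ?_
    obtain ⟨k, j⟩ := p
    rcases le_total j k with h | h
    · exact hkey j k h
    · rw [add_comm]; exact hkey k j h
  rw [hTs.tsum_add hTs', hTv', hTv] at hsum
  linarith

theorem expSeries_log_concaveOn (hb : ∃ A B, ∀ k, |c k| ≤ A * B ^ k) (hc : ∀ k, 0 < c k)
    (hlc : ∀ k, c k * c (k + 2) ≤ c (k + 1) ^ 2) :
    ConcaveOn ℝ (Ici 0) fun s => Real.log (expSeries c s) := by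
  have hd : ∀ s, 0 ≤ s → HasDerivAt (fun s => Real.log (expSeries c s))
      (expSeries (fun k => c (k + 1)) s / expSeries c s) s := fun s hs =>
    (expSeries_hasDerivAt hb s).log (expSeries_pos hb hc hs).ne'
  refine AntitoneOn.concaveOn_of_deriv (convex_Ici 0)
    (fun s hs => (hd s hs).continuousAt.continuousWithinAt)
    (fun s hs => (hd s (interior_subset hs)).differentiableAt.differentiableWithinAt) ?_
  intro s hs s' hs' hss
  have h0 : 0 ≤ s := interior_subset hs
  rw [(hd s h0).deriv, (hd s' (h0.trans hss)).deriv,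
    div_le_div_iff₀ (expSeries_pos hb hc (h0.trans hss)) (expSeries_pos hb hc h0)]
  exact expSeries_deriv_ratio hb hc hlc h0 hss

theorem prod_expSeries_le (hb : ∃ A B, ∀ k, |c k| ≤ A * B ^ k) (hc : ∀ k, 0 < c k)
    (hlc : ∀ k, c k * c (k + 2) ≤ c (k + 1) ^ 2) {n : ℕ} (hn : 0 < n) (s : Fin n → ℝ)
    (hs : ∀ i, 0 ≤ s i) : ∏ i, expSeries c (s i) ≤ expSeries c ((∑ i, s i) / n) ^ n := by
  have hn' : (0 : ℝ) < n := Nat.cast_pos.2 hn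
  have hpos : ∀ i, 0 < expSeries c (s i) := fun i => expSeries_pos hb hc (hs i)
  have havg : 0 ≤ (∑ i, s i) / n := div_nonneg (Finset.sum_nonneg fun i _ => hs i) hn'.le
  have h := (expSeries_log_concaveOn hb hc hlc).le_map_sum (t := Finset.univ)
    (w := fun _ : Fin n => (n : ℝ)⁻¹) (p := s) (fun _ _ => by positivity)
    (by simp [hn'.ne']) (fun i _ => hs i)
  simp only [smul_eq_mul, ← Finset.mul_sum] at h
  rw [← Real.log_le_log_iff (Finset.prod_pos fun i _ => hpos i) (pow_pos (expSeries_pos hb hc havg) _),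
    Real.log_prod (fun i _ => (hpos i).ne'), Real.log_pow, ← inv_mul_le_iff₀ hn', div_eq_inv_mul]
  exact h

theorem expSeries_le_exp (hb : ∃ A B, ∀ k, |c k| ≤ A * B ^ k) (hc : ∀ k, 0 < c k)
    (hlc : ∀ k, c k * c (k + 2) ≤ c (k + 1) ^ 2) {s : ℝ} (hs : 0 ≤ s) :
    expSeries c s ≤ c 0 * Real.exp (c 1 / c 0 * s) := by
  have hck : ∀ k, c k ≤ c 0 * (c 1 / c 0) ^ k := by
    intro k
    induction k with
    | zero => simp
    | succ k ih =>
      have h := ratio_antitone hc hlc (Nat.zero_le k)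
      simp only [zero_add] at h
      rw [div_le_iff₀ (hc k)] at h
      calc c (k + 1) ≤ c 1 / c 0 * c k := h
        _ ≤ c 1 / c 0 * (c 0 * (c 1 / c 0) ^ k) := by
            have := (div_pos (hc 1) (hc 0)).le
            gcongr
        _ = _ := by ring
  have hsum := (Real.summable_pow_div_factorial (c 1 / c 0 * s)).mul_left (c 0)
  have he : Real.exp (c 1 / c 0 * s) = ∑' k : ℕ, (c 1 / c 0 * s) ^ k / k.factorial := by
    rw [Real.exp_eq_exp_ℝ, NormedSpace.exp_eq_tsum_div]
  rw [he, ← tsum_mul_left]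
  refine (expSeries_summable hb s).of_norm.tsum_le_tsum (fun k => ?_) hsum
  rw [← mul_div_assoc, mul_pow, ← mul_assoc]
  gcongr
  exact hck k

end ExpSeries

/-! ### The marginal density and its moments. -/

section Marginal

variable {Ψ : ℝ → ℝ}

/-- The unnormalised density of one coordinate of the uniform distribution on the unit Orlicz ball
of dimension `m + 1`. -/
noncomputable def orliczMarginal (Ψ : ℝ → ℝ) (m : ℕ) (x : ℝ) : ℝ :=
  (orliczVolume Ψ m (1 - Ψ x)).toReal

theorem orliczMarginal_nonneg (m : ℕ) (x : ℝ) : 0 ≤ orliczMarginal Ψ m x := ENNReal.toReal_nonneg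

theorem orliczMarginal_measurable (hΨ : IsYoungFunction Ψ) (m : ℕ) :
    Measurable (orliczMarginal Ψ m) :=
  (measurable_comp_level hΨ (orliczIter_monotone _).measurable 1).ennreal_toReal

theorem orliczMarginal_le (hΨ : IsYoungFunction Ψ) (hev : Function.Even Ψ) (m : ℕ) (x : ℝ) :
    orliczMarginal Ψ m x ≤ (orliczVolume Ψ m 1).toReal :=
  ENNReal.toReal_mono (orliczVolume_ne_top hΨ hev m 1)
    (orliczIter_monotone _ (by linarith [hΨ.nonneg x]))

theorem orliczMarginal_eq_zero (hΨ : IsYoungFunction Ψ) (m : ℕ) {x : ℝ} (hx : 1 < Ψ x) :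
    orliczMarginal Ψ m x = 0 := by
  rw [orliczMarginal, orliczVolume, orliczIter_of_neg hΨ _ (by linarith), ENNReal.toReal_zero]

theorem orliczMarginal_pos (hΨ : IsYoungFunction Ψ) (hev : Function.Even Ψ) (m : ℕ) {x : ℝ}
    (hx : Ψ x < 1) : 0 < orliczMarginal Ψ m x :=
  ENNReal.toReal_pos (orliczVolume_pos hΨ m (by linarith)).ne' (orliczVolume_ne_top hΨ hev m _)

theorem integrable_mul_orliczMarginal (hΨ : IsYoungFunction Ψ) (hev : Function.Even Ψ) (m : ℕ)
    {f : ℝ → ℝ} (hf : Continuous f) : Integrable fun x => f x * orliczMarginal Ψ m x := by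
  obtain ⟨R, hR0, hR⟩ := hΨ.exists_abs_le hev 1
  have h : IntegrableOn (fun x => f x * orliczMarginal Ψ m x) (Icc (-R) R) :=
    (hf.integrableOn_Icc (a := -R) (b := R)).mul_bdd (c := (orliczVolume Ψ m 1).toReal)
      (orliczMarginal_measurable hΨ m).aestronglyMeasurable (Eventually.of_forall fun x => by
        rw [Real.norm_of_nonneg (orliczMarginal_nonneg m x)]; exact orliczMarginal_le hΨ hev m x)
  refine (integrableOn_iff_integrable_of_support_subset fun x hx => ?_).1 h
  by_contra hxR
  refine hx ?_
  have : 1 < Ψ x := not_le.1 fun hle => hxR (abs_le.1 (hR x hle))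
  simp only [orliczMarginal_eq_zero hΨ m this, mul_zero]

theorem orliczConv_eq_ofReal_integral (hΨ : IsYoungFunction Ψ) (hev : Function.Even Ψ) (m : ℕ)
    {f : ℝ → ℝ} (hf : Continuous f) (hf0 : ∀ x, 0 ≤ f x) :
    orliczConv Ψ (fun x => ENNReal.ofReal (f x)) (orliczVolume Ψ m) 1
      = ENNReal.ofReal (∫ x, f x * orliczMarginal Ψ m x) := by
  rw [ofReal_integral_eq_lintegral_ofReal (integrable_mul_orliczMarginal hΨ hev m hf)
    (Eventually.of_forall fun x => mul_nonneg (hf0 x) (orliczMarginal_nonneg m x))]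
  refine lintegral_congr fun x => ?_
  rw [ENNReal.ofReal_mul (hf0 x), orliczMarginal, ENNReal.ofReal_toReal (orliczVolume_ne_top hΨ hev m _)]

theorem orliczMarginal_circle (hΨ : IsYoungFunction Ψ) (hev : Function.Even Ψ)
    (hsq : ConvexOn ℝ (Ioi 0) (fun t : ℝ => Ψ (Real.sqrt t))) (m : ℕ) (x y x' y' : ℝ)
    (hc : x ^ 2 + y ^ 2 = x' ^ 2 + y' ^ 2) (hd : |x ^ 2 - y ^ 2| ≤ |x' ^ 2 - y' ^ 2|) :
    orliczMarginal Ψ m x' * orliczMarginal Ψ m y' ≤ orliczMarginal Ψ m x * orliczMarginal Ψ m y := by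
  simp only [orliczMarginal, ← ENNReal.toReal_mul]
  exact ENNReal.toReal_mono
    (ENNReal.mul_ne_top (orliczVolume_ne_top hΨ hev m _) (orliczVolume_ne_top hΨ hev m _))
    (level_mul_le_of_circle hΨ hev hsq (orliczIter_monotone _)
      (orliczVolume_isShiftLogConcave hΨ hev m) 1 hc hd)

/-- The even moments of the marginal, normalised so that their exponential series is the
symmetrised Laplace transform. -/
noncomputable def orliczMoment (Ψ : ℝ → ℝ) (m k : ℕ) : ℝ :=
  (∫ x, x ^ (2 * k) * orliczMarginal Ψ m x) * k.factorial / (2 * k).factorial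

theorem integral_even_pow_pos (hΨ : IsYoungFunction Ψ) (hev : Function.Even Ψ) (m k : ℕ) :
    0 < ∫ x, x ^ (2 * k) * orliczMarginal Ψ m x := by
  rw [integral_pos_iff_support_of_nonneg
    (fun x => mul_nonneg ((even_two_mul k).pow_nonneg x) (orliczMarginal_nonneg m x))
    (integrable_mul_orliczMarginal hΨ hev m (by fun_prop))]
  have ho : IsOpen {x : ℝ | Ψ x < 1 ∧ x ≠ 0} :=
    (isOpen_lt hΨ.continuous continuous_const).inter isOpen_ne
  obtain ⟨x, -, hx⟩ := hΨ.exists_nonneg_eq (show (0 : ℝ) ≤ 1 / 2 by norm_num)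
  refine lt_of_lt_of_le (ho.measure_pos volume ⟨x, by
    refine ⟨by rw [hx]; norm_num, fun h => ?_⟩
    rw [h, hΨ.map_zero] at hx
    norm_num at hx⟩) (measure_mono fun y hy => ?_)
  exact (mul_pos ((even_two_mul k).pow_pos hy.2) (orliczMarginal_pos hΨ hev m hy.1)).ne'

theorem orliczMoment_pos (hΨ : IsYoungFunction Ψ) (hev : Function.Even Ψ) (m k : ℕ) :
    0 < orliczMoment Ψ m k := by
  have := integral_even_pow_pos hΨ hev m k
  unfold orliczMoment
  positivity

theorem integral_even_pow_le (hΨ : IsYoungFunction Ψ) (hev : Function.Even Ψ) (m : ℕ) :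
    ∃ R, ∀ k, ∫ x, x ^ (2 * k) * orliczMarginal Ψ m x
      ≤ (R ^ 2) ^ k * ∫ x, orliczMarginal Ψ m x := by
  obtain ⟨R, hR0, hR⟩ := hΨ.exists_abs_le hev 1
  refine ⟨R, fun k => ?_⟩
  rw [← integral_const_mul]
  have hi : Integrable (orliczMarginal Ψ m) := by
    simpa using integrable_mul_orliczMarginal hΨ hev m (f := fun _ => 1) continuous_const
  refine integral_mono (integrable_mul_orliczMarginal hΨ hev m (by fun_prop)) (hi.const_mul _)
    fun x => ?_
  simp only []
  by_cases hx : Ψ x ≤ 1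
  · refine mul_le_mul_of_nonneg_right ?_ (orliczMarginal_nonneg m x)
    rw [pow_mul, ← sq_abs]
    exact pow_le_pow_left₀ (sq_nonneg _) (pow_le_pow_left₀ (abs_nonneg _) (hR x hx) 2) k
  · rw [orliczMarginal_eq_zero hΨ m (not_le.1 hx), mul_zero, mul_zero]

theorem orliczMoment_bound (hΨ : IsYoungFunction Ψ) (hev : Function.Even Ψ) (m : ℕ) :
    ∃ A B, ∀ k, |orliczMoment Ψ m k| ≤ A * B ^ k := by
  obtain ⟨R, hR⟩ := integral_even_pow_le hΨ hev m
  refine ⟨∫ x, orliczMarginal Ψ m x, R ^ 2, fun k => ?_⟩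
  rw [abs_of_pos (orliczMoment_pos hΨ hev m k), orliczMoment, mul_div_assoc, mul_comm (∫ x, _)]
  refine (mul_le_of_le_one_right (integral_even_pow_pos hΨ hev m k).le ?_).trans
    ((hR k).trans_eq (mul_comm _ _)) |> (le_of_eq_of_le (mul_comm _ _) ·)
  rw [div_le_one (by positivity)]
  exact_mod_cast Nat.factorial_le (by omega)

/-- The weights k!/(2k)! absorb exactly the factors 2k + 1 and 2k + 3 of `moment_log_concave`. -/
theorem orliczMoment_log_concave (hΨ : IsYoungFunction Ψ) (hev : Function.Even Ψ)
    (hsq : ConvexOn ℝ (Ioi 0) (fun t : ℝ => Ψ (Real.sqrt t))) (m k : ℕ) :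
    orliczMoment Ψ m k * orliczMoment Ψ m (k + 2) ≤ orliczMoment Ψ m (k + 1) ^ 2 := by
  have h := moment_log_concave (ρ := orliczMarginal Ψ m) (orliczMarginal_measurable hΨ m)
    ⟨_, fun x => by rw [abs_of_nonneg (orliczMarginal_nonneg m x)]
                    exact orliczMarginal_le hΨ hev m x⟩
    (fun j => integrable_mul_orliczMarginal hΨ hev m (by fun_prop))
    (orliczMarginal_circle hΨ hev hsq m) k
  simp only [orliczMoment, show 2 * (k + 2) = 2 * k + 4 by ring, show 2 * (k + 1) = 2 * k + 2 by ring]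
  set I := ∫ x, x ^ (2 * k) * orliczMarginal Ψ m x
  set J := ∫ x, x ^ (2 * k + 2) * orliczMarginal Ψ m x
  set K := ∫ x, x ^ (2 * k + 4) * orliczMarginal Ψ m x
  have e1 : ((2 * k + 2).factorial : ℝ) = (2 * k + 2) * (2 * k + 1) * (2 * k).factorial := by
    rw [Nat.factorial_succ, Nat.factorial_succ]; push_cast; ring
  have e2 : ((2 * k + 4).factorial : ℝ)
      = (2 * k + 4) * (2 * k + 3) * ((2 * k + 2) * (2 * k + 1) * (2 * k).factorial) := by
    rw [Nat.factorial_succ, Nat.factorial_succ, ← e1]; push_cast; ring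
  have e3 : ((k + 1).factorial : ℝ) = (k + 1) * k.factorial := by
    rw [Nat.factorial_succ]; push_cast; ring
  have e4 : ((k + 2).factorial : ℝ) = (k + 2) * ((k + 1) * k.factorial) := by
    rw [Nat.factorial_succ, ← e3]; push_cast; ring
  rw [e1, e2, e3, e4]
  have hf : (0 : ℝ) < (2 * k).factorial := by positivity
  set F : ℝ := (((2 * k).factorial : ℕ) : ℝ)
  set f : ℝ := ((k.factorial : ℕ) : ℝ)
  have l : I * f / F * (K * ((k + 2) * ((k + 1) * f))
        / ((2 * k + 4) * (2 * k + 3) * ((2 * k + 2) * (2 * k + 1) * F)))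
      = ((2 * k + 1) * (I * K)) * (f ^ 2 / (4 * (2 * k + 3) * (2 * k + 1) ^ 2 * F ^ 2)) := by
    field_simp
    ring
  have r : (J * ((k + 1) * f) / ((2 * k + 2) * (2 * k + 1) * F)) ^ 2
      = ((2 * k + 3) * J ^ 2) * (f ^ 2 / (4 * (2 * k + 3) * (2 * k + 1) ^ 2 * F ^ 2)) := by
    field_simp
    ring
  rw [l, r]
  exact mul_le_mul_of_nonneg_right h (by positivity)

theorem integral_cosh_eq_expSeries (hΨ : IsYoungFunction Ψ) (hev : Function.Even Ψ) (m : ℕ)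
    (a : ℝ) : ∫ x, Real.cosh (a * x) * orliczMarginal Ψ m x
      = expSeries (orliczMoment Ψ m) (a ^ 2) := by
  set F : ℕ → ℝ → ℝ := fun k x => (a * x) ^ (2 * k) / (2 * k).factorial * orliczMarginal Ψ m x
    with hF
  have hFi : ∀ k, Integrable (F k) := fun k => integrable_mul_orliczMarginal hΨ hev m (by fun_prop)
  have hFv : ∀ k, ∫ x, F k x = orliczMoment Ψ m k * (a ^ 2) ^ k / k.factorial := by
    intro k
    have : ∀ x, F k x = (a ^ 2) ^ k / (2 * k).factorial * (x ^ (2 * k) * orliczMarginal Ψ m x) := by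
      intro x; simp only [hF, mul_pow, pow_mul]; ring
    simp only [this]
    rw [integral_const_mul, orliczMoment]
    field_simp
  have hFn : ∀ k x, ‖F k x‖ = F k x := fun k x => Real.norm_of_nonneg
    (mul_nonneg (div_nonneg ((even_two_mul k).pow_nonneg _) (Nat.cast_nonneg _))
      (orliczMarginal_nonneg m x))
  have hs := hasSum_integral_of_summable_integral_norm hFi (by
    simp only [hFn, hFv]
    exact (expSeries_summable (orliczMoment_bound hΨ hev m) (a ^ 2)).of_norm)
  simp only [hFv] at hs
  rw [expSeries, hs.tsum_eq]
  refine integral_congr_ae (Eventually.of_forall fun x => ?_)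
  simp only [hF]
  rw [tsum_mul_right, ← Real.cosh_eq_tsum]

end Marginal

/-! ### The uniform distribution on the ball and its symmetries. -/

section Ball

variable {Ψ : ℝ → ℝ}

theorem lintegral_pi_eq_orliczIter (hΨ : IsYoungFunction Ψ) {n : ℕ} (f : Fin n → ℝ → ℝ≥0∞)
    (hf : ∀ i, Measurable (f i)) (r : ℝ) :
    ∫⁻ x : Fin n → ℝ, (∏ i, f i (x i)) * (Ici 0).indicator 1 (r - ∑ i, Ψ (x i))
      = orliczIter Ψ (List.ofFn f) r := by
  induction n generalizing r with
  | zero =>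
    rw [volume_pi]
    simp [orliczIter]
  | succ n ih =>
    have hΨm := hΨ.continuous.measurable
    have hind : Measurable ((Ici (0 : ℝ)).indicator (1 : ℝ → ℝ≥0∞)) :=
      measurable_one.indicator measurableSet_Ici
    rw [← (volume_preserving_piFinSuccAbove (fun _ : Fin (n + 1) => ℝ) 0).symm.lintegral_comp_emb
      (MeasurableEquiv.measurableEmbedding _), Measure.volume_eq_prod, lintegral_prod,
      List.ofFn_succ, orliczIter, orliczConv]
    · refine lintegral_congr fun x => ?_
      rw [← ih (fun i => f i.succ) (fun i => hf _), ← lintegral_const_mul]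
      · refine lintegral_congr fun y => ?_
        simp only [MeasurableEquiv.piFinSuccAbove_symm_apply, Fin.insertNthEquiv_zero,
          Fin.consEquiv_apply, Fin.prod_univ_succ, Fin.sum_univ_succ, Fin.cons_zero, Fin.cons_succ]
        rw [mul_assoc, sub_sub]
      · fun_prop
    · refine Measurable.aemeasurable ?_
      refine Measurable.comp (g := fun x : Fin (n + 1) → ℝ =>
        (∏ i, f i (x i)) * (Ici 0).indicator 1 (r - ∑ i, Ψ (x i))) ?_
        (MeasurableEquiv.measurable _)
      fun_prop

theorem orliczBall_isCompact (hΨ : IsYoungFunction Ψ) (hev : Function.Even Ψ) (n : ℕ) :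
    IsCompact (orliczBall n Ψ) := by
  have hc := hΨ.continuous
  obtain ⟨R, hR0, hR⟩ := hΨ.exists_abs_le hev 1
  refine Metric.isCompact_of_isClosed_isBounded
    (isClosed_le (by fun_prop) continuous_const) ?_
  refine (Metric.isBounded_closedBall (x := 0) (r := Real.sqrt (∑ _i : Fin n, R ^ 2))).subset
    fun x hx => ?_
  rw [mem_closedBall_zero_iff, EuclideanSpace.norm_eq]
  refine Real.sqrt_le_sqrt (Finset.sum_le_sum fun i _ => ?_)
  refine pow_le_pow_left₀ (norm_nonneg _) (hR _ ?_) 2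
  have hx' : ∑ i, Ψ (x i) ≤ 1 := hx
  exact (Finset.single_le_sum (f := fun i => Ψ (x i)) (fun j _ => hΨ.nonneg _)
    (Finset.mem_univ i)).trans hx'

theorem setLIntegral_orliczBall (hΨ : IsYoungFunction Ψ) (hev : Function.Even Ψ) {n : ℕ}
    (f : Fin n → ℝ → ℝ≥0∞) (hf : ∀ i, Measurable (f i)) :
    ∫⁻ x in orliczBall n Ψ, ∏ i, f i (x i) = orliczIter Ψ (List.ofFn f) 1 := by
  have hmp := EuclideanSpace.volume_preserving_symm_measurableEquiv_toLp (Fin n)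
  rw [← lintegral_pi_eq_orliczIter hΨ f hf,
    ← hmp.lintegral_comp_emb (MeasurableEquiv.measurableEmbedding _),
    ← lintegral_indicator (orliczBall_isCompact hΨ hev n).measurableSet]
  refine lintegral_congr fun x => ?_
  by_cases hx : ∑ i, Ψ (x i) ≤ 1
  · rw [indicator_of_mem (show x ∈ orliczBall n Ψ from hx),
      indicator_of_mem (by simpa using hx)]
    simp
  · rw [indicator_of_notMem (show x ∉ orliczBall n Ψ from hx),
      indicator_of_notMem (by simpa using hx), mul_zero]

theorem volume_orliczBall (hΨ : IsYoungFunction Ψ) (hev : Function.Even Ψ) (n : ℕ) :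
    volume (orliczBall n Ψ) = orliczVolume Ψ n 1 := by
  have h := setLIntegral_orliczBall hΨ hev (n := n) (fun _ => 1) (fun _ => measurable_one)
  simpa [List.ofFn_const, orliczVolume] using h

/-- Averaging over x ↦ -x, which fixes Ψ. Negative association needs functions increasing in |x|;
cosh is one, the exponential is not. -/
theorem orliczConv_exp_eq_cosh (hΨ : IsYoungFunction Ψ) (hev : Function.Even Ψ) {W : ℝ → ℝ≥0∞}
    (hW : Measurable W) (a : ℝ) :
    orliczConv Ψ (fun x => ENNReal.ofReal (Real.exp (a * x))) W
      = orliczConv Ψ (fun x => ENNReal.ofReal (Real.cosh (a * x))) W := by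
  ext r
  have hm : ∀ a : ℝ, Measurable fun x =>
      ENNReal.ofReal (Real.exp (a * x)) * W (r - Ψ x) := fun a =>
    (by fun_prop : Measurable fun x => ENNReal.ofReal (Real.exp (a * x))).mul
      (measurable_comp_level hΨ hW r)
  have hneg : ∫⁻ x, ENNReal.ofReal (Real.exp (-a * x)) * W (r - Ψ x)
      = ∫⁻ x, ENNReal.ofReal (Real.exp (a * x)) * W (r - Ψ x) := by
    have h := lintegral_neg_eq_self (μ := (volume : Measure ℝ))
      (fun x => ENNReal.ofReal (Real.exp (a * x)) * W (r - Ψ x))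
    rw [← h]
    refine lintegral_congr fun x => ?_
    rw [hev x, neg_mul_comm]
  rw [orliczConv, orliczConv, ← ENNReal.mul_right_inj (a := 2) (by norm_num) (by norm_num)]
  conv_lhs => rw [two_mul]
  nth_rw 2 [← hneg]
  rw [← lintegral_add_left (hm a), ← lintegral_const_mul' _ _ (by norm_num)]
  refine lintegral_congr fun x => ?_
  rw [← add_mul, ← ENNReal.ofReal_add (Real.exp_nonneg _) (Real.exp_nonneg _), ← mul_assoc,
    ← ENNReal.ofReal_ofNat, ← ENNReal.ofReal_mul (by norm_num), Real.cosh_eq, neg_mul]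
  congr 2
  ring

theorem orliczIter_exp_eq_cosh (hΨ : IsYoungFunction Ψ) (hev : Function.Even Ψ) (l : List ℝ) :
    orliczIter Ψ (l.map fun a x => ENNReal.ofReal (Real.exp (a * x)))
      = orliczIter Ψ (l.map fun a x => ENNReal.ofReal (Real.cosh (a * x))) := by
  induction l with
  | nil => rfl
  | cons a l ih =>
    simp only [List.map_cons, orliczIter]
    rw [ih, orliczConv_exp_eq_cosh hΨ hev (orliczIter_monotone _).measurable]

/-- The uniform distribution on the unit Orlicz ball. -/
noncomputable def orliczUniform (n : ℕ) (Ψ : ℝ → ℝ) : Measure (EuclideanSpace ℝ (Fin n)) :=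
  ProbabilityTheory.cond volume (orliczBall n Ψ)

theorem orliczUniform_integrable (hΨ : IsYoungFunction Ψ) (hev : Function.Even Ψ) (n : ℕ)
    {g : EuclideanSpace ℝ (Fin n) → ℝ} (hg : Continuous g) : Integrable g (orliczUniform n Ψ) := by
  refine Integrable.smul_measure
    (hg.continuousOn.integrableOn_compact (orliczBall_isCompact hΨ hev n)) ?_
  rw [volume_orliczBall hΨ hev]
  exact ENNReal.inv_ne_top.2 (orliczVolume_pos hΨ n one_pos).ne'

theorem orliczUniform_lintegral_prod (hΨ : IsYoungFunction Ψ) (hev : Function.Even Ψ) {n : ℕ}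
    (f : Fin n → ℝ → ℝ≥0∞) (hf : ∀ i, Measurable (f i)) :
    ∫⁻ x, ∏ i, f i (x i) ∂(orliczUniform n Ψ)
      = orliczIter Ψ (List.ofFn f) 1 / orliczVolume Ψ n 1 := by
  rw [orliczUniform, ProbabilityTheory.cond, lintegral_smul_measure, setLIntegral_orliczBall hΨ hev f hf,
    volume_orliczBall hΨ hev, smul_eq_mul, ENNReal.div_eq_inv_mul]

/-- Used for a sign change of one coordinate, which makes coordinates uncorrelated, and for a
transposition, which makes second moments equal. -/
theorem orliczUniform_integral_comp {n : ℕ}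
    (e : EuclideanSpace ℝ (Fin n) ≃ₗᵢ[ℝ] EuclideanSpace ℝ (Fin n))
    (he : ∀ x, ∑ i, Ψ (e x i) = ∑ i, Ψ (x i)) (g : EuclideanSpace ℝ (Fin n) → ℝ) :
    ∫ x, g (e x) ∂(orliczUniform n Ψ) = ∫ x, g x ∂(orliczUniform n Ψ) := by
  have hpre : e ⁻¹' orliczBall n Ψ = orliczBall n Ψ := by
    ext x
    simp only [orliczBall, mem_preimage, mem_ofPred_eq, he]
  have h := e.measurePreserving.setIntegral_preimage_emb
    e.toHomeomorph.measurableEmbedding g (orliczBall n Ψ)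
  rw [hpre] at h
  rw [orliczUniform, ProbabilityTheory.cond, integral_smul_measure, integral_smul_measure, h]

theorem orliczUniform_integral_mul_of_ne (hev : Function.Even Ψ) {n : ℕ} {i j : Fin n}
    (hij : i ≠ j) : ∫ x, x i * x j ∂(orliczUniform n Ψ) = 0 := by
  let e : EuclideanSpace ℝ (Fin n) ≃ₗᵢ[ℝ] EuclideanSpace ℝ (Fin n) :=
    LinearIsometryEquiv.piLpCongrRight 2 fun k =>
      if k = i then LinearIsometryEquiv.neg ℝ else LinearIsometryEquiv.refl ℝ ℝ
  have he : ∀ x k, e x k = if k = i then -x k else x k := by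
    intro x k
    simp only [e, LinearIsometryEquiv.piLpCongrRight_apply]
    split_ifs <;> simp
  have h := orliczUniform_integral_comp (Ψ := Ψ) e (fun x => Finset.sum_congr rfl fun k _ => by
    rw [he]; split_ifs <;> simp [hev _]) (fun x => x i * x j)
  simp only [he, if_true, if_neg hij.symm, neg_mul, integral_neg] at h
  linarith

theorem orliczUniform_integral_sq_eq {n : ℕ} (i j : Fin n) :
    ∫ x, x i ^ 2 ∂(orliczUniform n Ψ) = ∫ x, x j ^ 2 ∂(orliczUniform n Ψ) := by
  let e : EuclideanSpace ℝ (Fin n) ≃ₗᵢ[ℝ] EuclideanSpace ℝ (Fin n) :=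
    LinearIsometryEquiv.piLpCongrLeft 2 ℝ ℝ (Equiv.swap i j)
  have he : ∀ x k, e x k = x (Equiv.swap i j k) := by
    intro x k
    simp [e, LinearIsometryEquiv.piLpCongrLeft_apply, Equiv.piCongrLeft']
  have h := orliczUniform_integral_comp (Ψ := Ψ) e (fun x => by
    simp only [he]
    exact Equiv.sum_comp (Equiv.swap i j) fun k => Ψ (x k)) (fun x => x j ^ 2)
  simpa only [he, Equiv.swap_apply_right] using h

theorem orliczUniform_integral_inner_sq (hΨ : IsYoungFunction Ψ) (hev : Function.Even Ψ) {n : ℕ}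
    (a : EuclideanSpace ℝ (Fin n)) (j : Fin n) :
    ∫ x, (inner ℝ a x) ^ 2 ∂(orliczUniform n Ψ)
      = ‖a‖ ^ 2 * ∫ x, x j ^ 2 ∂(orliczUniform n Ψ) := by
  have hexp : ∀ x : EuclideanSpace ℝ (Fin n), (inner ℝ a x) ^ 2
      = ∑ i, ∑ k, a i * a k * (x i * x k) := by
    intro x
    rw [PiLp.inner_apply, pow_two, Finset.sum_mul_sum]
    refine Finset.sum_congr rfl fun i _ => Finset.sum_congr rfl fun k _ => ?_
    simp only [RCLike.inner_apply, conj_trivial]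
    ring
  have hint : ∀ i k, Integrable (fun x : EuclideanSpace ℝ (Fin n) => a i * a k * (x i * x k))
      (orliczUniform n Ψ) := fun i k => orliczUniform_integrable hΨ hev n (by fun_prop)
  simp only [hexp]
  rw [integral_finsetSum _ fun i _ => integrable_finsetSum _ fun k _ => hint i k]
  simp only [integral_finsetSum _ fun k _ => hint _ k, integral_const_mul]
  rw [EuclideanSpace.norm_sq_eq, Finset.sum_mul]
  refine Finset.sum_congr rfl fun i _ => ?_
  rw [Finset.sum_eq_single i]
  · rw [orliczUniform_integral_sq_eq j i, Real.norm_eq_abs, sq_abs]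
    simp only [pow_two]
  · intro k _ hk
    rw [orliczUniform_integral_mul_of_ne hev hk.symm, mul_zero]
  · simp

end Ball

/-! ### Laplace transforms in terms of the moment series. -/

section Laplace

variable {Ψ : ℝ → ℝ}

theorem orliczMoment_zero (m : ℕ) : orliczMoment Ψ m 0 = ∫ x, orliczMarginal Ψ m x := by
  simp [orliczMoment]

theorem orliczVolume_succ_eq_ofReal (hΨ : IsYoungFunction Ψ) (hev : Function.Even Ψ) (m : ℕ) :
    orliczVolume Ψ (m + 1) 1 = ENNReal.ofReal (orliczMoment Ψ m 0) := by
  have h := orliczConv_eq_ofReal_integral hΨ hev m (f := fun _ => 1) continuous_const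
    (fun _ => zero_le_one)
  simp only [ENNReal.ofReal_one, one_mul] at h
  rw [orliczMoment_zero, ← h]
  rfl

theorem orliczConv_cosh_eq (hΨ : IsYoungFunction Ψ) (hev : Function.Even Ψ) (m : ℕ) (a : ℝ) :
    orliczConv Ψ (fun x => ENNReal.ofReal (Real.cosh (a * x))) (orliczVolume Ψ m) 1
      = ENNReal.ofReal (expSeries (orliczMoment Ψ m) (a ^ 2)) := by
  rw [orliczConv_eq_ofReal_integral hΨ hev m (by fun_prop) (fun x => (Real.cosh_pos _).le),
    integral_cosh_eq_expSeries hΨ hev]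

theorem orliczUniform_integral_coord (hΨ : IsYoungFunction Ψ) (hev : Function.Even Ψ) (m : ℕ)
    {f : ℝ → ℝ} (hf : Continuous f) (hf0 : ∀ x, 0 ≤ f x) :
    ∫ x, f (x 0) ∂(orliczUniform (m + 1) Ψ)
      = (orliczConv Ψ (fun x => ENNReal.ofReal (f x)) (orliczVolume Ψ m) 1).toReal
        / orliczMoment Ψ m 0 := by
  have h := orliczUniform_lintegral_prod hΨ hev
    (Fin.cons (fun x => ENNReal.ofReal (f x)) (fun _ => 1) : Fin (m + 1) → ℝ → ℝ≥0∞)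
    (fun i => by
      refine Fin.cases ?_ (fun i => ?_) i
      · exact hf.measurable.ennreal_ofReal
      · exact measurable_one)
  simp only [Fin.prod_univ_succ, Fin.cons_zero, Fin.cons_succ, Pi.one_apply, Finset.prod_const_one,
    mul_one, List.ofFn_succ, List.ofFn_const] at h
  rw [integral_eq_lintegral_of_nonneg_ae (Eventually.of_forall fun x => hf0 _)
    (orliczUniform_integrable hΨ hev _ (by fun_prop)).aestronglyMeasurable, h, ENNReal.toReal_div,
    orliczVolume_succ_eq_ofReal hΨ hev, ENNReal.toReal_ofReal (orliczMoment_pos hΨ hev m 0).le]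
  rfl

theorem orliczUniform_integral_exp_coord (hΨ : IsYoungFunction Ψ) (hev : Function.Even Ψ) (m : ℕ)
    (c : ℝ) : ∫ x, Real.exp (c * x 0) ∂(orliczUniform (m + 1) Ψ)
      = expSeries (orliczMoment Ψ m) (c ^ 2) / orliczMoment Ψ m 0 := by
  rw [orliczUniform_integral_coord hΨ hev m (f := fun t => Real.exp (c * t)) (by fun_prop)
    (fun x => (Real.exp_pos _).le),
    orliczConv_exp_eq_cosh hΨ hev (W := orliczVolume Ψ m) (orliczIter_monotone _).measurable,
    orliczConv_cosh_eq hΨ hev,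
    ENNReal.toReal_ofReal (expSeries_pos (orliczMoment_bound hΨ hev m)
      (orliczMoment_pos hΨ hev m) (sq_nonneg c)).le]

theorem orliczUniform_integral_sq (hΨ : IsYoungFunction Ψ) (hev : Function.Even Ψ) (m : ℕ) :
    ∫ x, x 0 ^ 2 ∂(orliczUniform (m + 1) Ψ)
      = 2 * (orliczMoment Ψ m 1 / orliczMoment Ψ m 0) := by
  have h2 := integral_even_pow_pos hΨ hev m 1
  rw [orliczUniform_integral_coord hΨ hev m (f := fun t => t ^ 2) (by fun_prop)
    (fun x => sq_nonneg x), orliczConv_eq_ofReal_integral hΨ hev m (by fun_prop) sq_nonneg,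
    ENNReal.toReal_ofReal h2.le]
  have h1 : orliczMoment Ψ m 1 = (∫ x, x ^ 2 * orliczMarginal Ψ m x) / 2 := by
    simp [orliczMoment]
  rw [h1]
  ring

theorem orliczUniform_integral_exp_inner_le (hΨ : IsYoungFunction Ψ) (hev : Function.Even Ψ) (m : ℕ)
    (a : EuclideanSpace ℝ (Fin (m + 1))) :
    ∫ x, Real.exp (inner ℝ a x) ∂(orliczUniform (m + 1) Ψ)
      ≤ (∏ i, expSeries (orliczMoment Ψ m) (a i ^ 2)) / orliczMoment Ψ m 0 ^ (m + 1) := by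
  have hc0 := orliczMoment_pos hΨ hev m 0
  have hF : ∀ i, 0 ≤ expSeries (orliczMoment Ψ m) (a i ^ 2) := fun i =>
    (expSeries_pos (orliczMoment_bound hΨ hev m) (orliczMoment_pos hΨ hev m) (sq_nonneg _)).le
  set E := ∫ x, Real.exp (inner ℝ a x) ∂(orliczUniform (m + 1) Ψ) with hE
  have hE0 : 0 ≤ E := integral_nonneg fun x => (Real.exp_pos _).le
  set l := List.ofFn fun i => a i with hl
  have hexp : ENNReal.ofReal E
      = orliczIter Ψ (l.map fun a x => ENNReal.ofReal (Real.cosh (a * x))) 1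
        / ENNReal.ofReal (orliczMoment Ψ m 0) := by
    rw [hE, ofReal_integral_eq_lintegral_ofReal
      (orliczUniform_integrable hΨ hev _ (by fun_prop)) (Eventually.of_forall fun x => (Real.exp_pos _).le),
      ← orliczIter_exp_eq_cosh hΨ hev, ← orliczVolume_succ_eq_ofReal hΨ hev, hl, List.map_ofFn,
      ← orliczUniform_lintegral_prod hΨ hev]
    · refine lintegral_congr fun x => ?_
      simp only [Function.comp_apply]
      rw [← ENNReal.ofReal_prod_of_nonneg fun i _ => (Real.exp_pos _).le, ← Real.exp_sum,
        PiLp.inner_apply]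
      simp only [RCLike.inner_apply, conj_trivial, mul_comm]
    · intro i
      simp only [Function.comp_apply]
      fun_prop
  rw [ENNReal.eq_div_iff (by simpa using hc0) ENNReal.ofReal_ne_top] at hexp
  -- The list already has m + 1 entries, so no padding is needed.
  have hna := orliczIter_negative_association hΨ hev
    (l.map fun a x => ENNReal.ofReal (Real.cosh (a * x))) (fun f hf => by
      obtain ⟨b, -, rfl⟩ := List.mem_map.1 hf
      refine ⟨by fun_prop, fun x y hxy => ENNReal.ofReal_le_ofReal (Real.cosh_le_cosh.2 ?_)⟩
      rw [abs_mul, abs_mul]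
      gcongr) 0 m (by simp [hl]) 1
  rw [List.replicate_zero, List.append_nil, ← hexp, List.length_map, List.map_map, hl,
    List.length_ofFn, List.map_ofFn, List.prod_ofFn, orliczVolume_succ_eq_ofReal hΨ hev] at hna
  simp only [Function.comp_apply, orliczConv_cosh_eq hΨ hev] at hna
  rw [← ENNReal.ofReal_prod_of_nonneg fun i _ => hF i, ← ENNReal.ofReal_pow hc0.le,
    ← ENNReal.ofReal_mul hc0.le, ← ENNReal.ofReal_mul (by positivity), ← ENNReal.ofReal_mul
      (Finset.prod_nonneg fun i _ => hF i), ENNReal.ofReal_le_ofReal_iff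
      (mul_nonneg (Finset.prod_nonneg fun i _ => hF i) hc0.le)] at hna
  rw [le_div_iff₀ (by positivity)]
  refine le_of_mul_le_mul_right ?_ hc0
  linarith

end Laplace

theorem mainTheorem8 (n : ℕ) (hn : 0 < n)
    (Ψ : ℝ → ℝ) (hΨ : IsYoungFunction Ψ) (hΨ_even : Function.Even Ψ)
    (hΨ_sqrt : ConvexOn ℝ (Set.Ioi 0) (fun t : ℝ => Ψ (Real.sqrt t)))
    {Ω : Type*} [MeasurableSpace Ω] (μ : MeasureTheory.Measure Ω)
    [MeasureTheory.IsProbabilityMeasure μ]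
    (ξ : Ω → EuclideanSpace ℝ (Fin n))
    (hξ : MeasureTheory.pdf.IsUniform ξ (orliczBall n Ψ) μ MeasureTheory.volume)
    (a : EuclideanSpace ℝ (Fin n)) :
    MeasureTheory.Integrable (fun ω => Real.exp (inner ℝ a (ξ ω))) μ ∧
    MeasureTheory.Integrable
      (fun ω => Real.exp (‖a‖ / Real.sqrt n * ξ ω ⟨0, hn⟩)) μ ∧
    MeasureTheory.Integrable (fun ω => (inner ℝ a (ξ ω)) ^ 2) μ ∧
    ∫ ω, Real.exp (inner ℝ a (ξ ω)) ∂μ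
      ≤ (∫ ω, Real.exp (‖a‖ / Real.sqrt n * ξ ω ⟨0, hn⟩) ∂μ) ^ n ∧
    (∫ ω, Real.exp (‖a‖ / Real.sqrt n * ξ ω ⟨0, hn⟩) ∂μ) ^ n
      ≤ Real.exp ((1 / 2) * ∫ ω, (inner ℝ a (ξ ω)) ^ 2 ∂μ) := by
  have hvol := volume_orliczBall hΨ hΨ_even n
  -- Measurability of ξ is not assumed; it follows because the ball has positive finite volume, so
  -- the law of ξ is not the zero measure.
  have hξm : AEMeasurable ξ μ := hξ.aemeasurable
    (hvol ▸ (orliczVolume_pos hΨ n one_pos).ne') (hvol ▸ orliczVolume_ne_top hΨ hΨ_even n 1)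
  have hmap : μ.map ξ = orliczUniform n Ψ := hξ
  have hint : ∀ g : EuclideanSpace ℝ (Fin n) → ℝ, Continuous g → Integrable (fun ω => g (ξ ω)) μ :=
    fun g hg => (hmap ▸ orliczUniform_integrable hΨ hΨ_even n hg :
      Integrable g (μ.map ξ)).comp_aemeasurable hξm
  have hval : ∀ g : EuclideanSpace ℝ (Fin n) → ℝ, Continuous g →
      ∫ ω, g (ξ ω) ∂μ = ∫ x, g x ∂(orliczUniform n Ψ) := fun g hg => by
    rw [← hmap, integral_map hξm hg.aestronglyMeasurable]
  refine ⟨hint (fun x => Real.exp (inner ℝ a x)) (by fun_prop),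
    hint (fun x => Real.exp (‖a‖ / Real.sqrt n * x ⟨0, hn⟩)) (by fun_prop),
    hint (fun x => (inner ℝ a x) ^ 2) (by fun_prop), ?_⟩
  rw [hval (fun x => Real.exp (inner ℝ a x)) (by fun_prop),
    hval (fun x => Real.exp (‖a‖ / Real.sqrt n * x ⟨0, hn⟩)) (by fun_prop),
    hval (fun x => (inner ℝ a x) ^ 2) (by fun_prop)]
  obtain ⟨m, rfl⟩ := Nat.exists_eq_succ_of_ne_zero hn.ne'
  have hc := orliczMoment_pos hΨ hΨ_even m
  have hb := orliczMoment_bound hΨ hΨ_even m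
  have hlc := orliczMoment_log_concave hΨ hΨ_even hΨ_sqrt m
  have hn' : (0 : ℝ) < (m + 1 : ℕ) := Nat.cast_pos.2 hn
  -- The exponent |a|/√n is chosen so that its square is the mean of the aᵢ², the point where Jensen
  -- evaluates the series.
  have hsq : (‖a‖ / Real.sqrt (m + 1 : ℕ)) ^ 2 = (∑ i, a i ^ 2) / (m + 1 : ℕ) := by
    rw [div_pow, Real.sq_sqrt hn'.le, EuclideanSpace.norm_sq_eq]
    simp only [Real.norm_eq_abs, sq_abs]
  have hcoord : ∫ x, Real.exp (‖a‖ / Real.sqrt (m + 1 : ℕ) * x ⟨0, hn⟩) ∂(orliczUniform (m + 1) Ψ)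
      = expSeries (orliczMoment Ψ m) ((∑ i, a i ^ 2) / (m + 1 : ℕ)) / orliczMoment Ψ m 0 := by
    rw [← hsq]
    exact orliczUniform_integral_exp_coord hΨ hΨ_even m _
  rw [hcoord]
  constructor
  · refine (orliczUniform_integral_exp_inner_le hΨ hΨ_even m a).trans ?_
    rw [div_pow]
    exact div_le_div_of_nonneg_right (prod_expSeries_le hb hc hlc hn (fun i => a i ^ 2)
      fun i => sq_nonneg _) (pow_pos (hc 0) _).le
  · have havg : 0 ≤ (∑ i, a i ^ 2) / (m + 1 : ℕ) :=
      div_nonneg (Finset.sum_nonneg fun i _ => sq_nonneg _) hn'.le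
    rw [orliczUniform_integral_inner_sq hΨ hΨ_even a 0, orliczUniform_integral_sq hΨ hΨ_even]
    -- The power n cancels the mean's denominator, leaving |a|² c₁/c₀, where 2 c₁/c₀ is the second
    -- moment of a coordinate.
    calc _ ≤ Real.exp (orliczMoment Ψ m 1 / orliczMoment Ψ m 0
            * ((∑ i, a i ^ 2) / (m + 1 : ℕ))) ^ (m + 1) := by
          refine pow_le_pow_left₀ (div_nonneg (expSeries_pos hb hc havg).le (hc 0).le) ?_ _
          rw [div_le_iff₀' (hc 0)]
          exact expSeries_le_exp hb hc hlc havg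
      _ = _ := by
          rw [← Real.exp_nat_mul, ← hsq, div_pow, Real.sq_sqrt hn'.le]
          congr 1
          field_simp
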